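/- For a real number $p>0$ and a strictly increasing sequence of real numbers $\tau=(\tau_n)_{n\ge 0}$ with $\tau_0=0$, define \[ E_p(\tau)=\int_0^\infty \bigl(\max(0,K_p(\tau;x))\bigr)^2\,dx,\qquad K_p(\tau;x)=\sum_{n=0}^\infty \chi_{(\tau_n,\tau_{n+1})}(x)\,\frac{\sin\bigl(\frac p2\pi(x-n)\bigr)}{\pi x}, \] where $\chi_{(a,b)}$ is the characteristic function of the interval $(a,b)$. For $\delta_1,\delta_2>0$ let \[ T(\delta_1,\delta_2)=\{\tau=(\tau_n)_{n\ge 0}:\ \tau_0=0,\ \tau_1\ge\delta_1,\ \tau_{n+1}-\tau_n\ge\delta_2\ \text{for all } n\ge 1\}, \qquad \mathscr{E}_p(\delta_1,\delta_2)=\sup_{\tau\in T(\delta_1,\delta_2)}E_p(\tau). \] Fix $4<p\le 5$ and let $\frac12\le\delta_1\le\frac12+\frac3p$ and $1-\frac2p\le\delta_2\le 1$. Then the integrals $E_p(\tau)$, $\tau\in T(\delta_1,\delta_2)$, and the series below converge, the supremum is finite, and \[ \begin{aligned} \mathscr{E}_p(\delta_1,\delta_2)={}&\int_0^{2/p}\frac{\sin^2\bigl(\frac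 p2\pi x\bigr)}{\pi^2x^2}\,dx +\sum_{n=0}^\infty\int_{n+4/p}^{n+1/2+3/p}\frac{\sin^2\bigl(\frac p2\pi(x-n)\bigr)}{\pi^2x^2}\,dx\\ &+\sum_{n=0}^\infty\int_{n+1/2+3/p}^{n+1+2/p}\frac{\sin^2\bigl(\frac p2\pi(x-n-1)\bigr)}{\pi^2x^2}\,dx . \end{aligned} \] Moreover, a sequence $\tau\in T(\delta_1,\delta_2)$ attains the supremum if and only if $\tau_n=n-\frac12+\frac3p$ for all $n\ge 1$, and this sequence belongs to $T(\delta_1,\delta_2)$. -/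

import Mathlib

open scoped Real
open MeasureTheory Set

noncomputable section

/-- The kernel `K_p(τ; x) = ∑_{n ≥ 0} χ_{(τ_n, τ_{n+1})}(x) sin((p/2) π (x - n)) / (π x)`.
For a strictly increasing `τ` at most one term is nonzero at each point `x`. -/
def kernelK (p : ℝ) (τ : ℕ → ℝ) (x : ℝ) : ℝ :=
  ∑' n : ℕ, (Ioo (τ n) (τ (n + 1))).indicator
    (fun y : ℝ => Real.sin (p / 2 * π * (y - n)) / (π * y)) x

/-- The functional `E_p(τ) = ∫_0^∞ (max (0, K_p(τ; x)))² dx`. -/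
def energyE (p : ℝ) (τ : ℕ → ℝ) : ℝ :=
  ∫ x in Ioi (0 : ℝ), (max 0 (kernelK p τ x)) ^ 2

/-- The set `T(δ₁, δ₂)` of sequences with `τ_0 = 0`, `τ_1 ≥ δ₁` and `τ_{n+1} - τ_n ≥ δ₂` for all
`n ≥ 1`. For `δ₁, δ₂ > 0` such sequences are automatically strictly increasing. -/
def sepSeq (δ₁ δ₂ : ℝ) : Set (ℕ → ℝ) :=
  {τ | τ 0 = 0 ∧ δ₁ ≤ τ 1 ∧ ∀ n : ℕ, 1 ≤ n → δ₂ ≤ τ (n + 1) - τ n}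

/-- The value `𝓔_p(δ₁, δ₂) = sup_{τ ∈ T(δ₁, δ₂)} E_p(τ)` of the optimization problem. -/
def supE (p δ₁ δ₂ : ℝ) : ℝ :=
  sSup (energyE p '' sepSeq δ₁ δ₂)

end

/-!
Write `P = 4 / p` and `ε = 1 - 4 / p`. Up to the factor `1 / (π x)²` the integrand of `E_p(τ)` is
`density p τ x = bump p (x - n - 1 / p)`, where `n` is the number of switches made up to `x` and
`bump p z = max(0, cos (p π z / 2))²` has period `P`. Hence a switch `n → n + 1` sets the phase back
by `1 - P = ε`, and integrating piece by piece gives, for `t ∈ [τ_n, τ_{n+1}]`,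
`∫₀ᵗ density = K(t - n ε - 1/p) - K(-1/p) + ∑_{j ≤ n} w(a_j)` with `K = ∫ bump`
(`HalfSeparated.integral_density`). Here `w(r)` is the mass of `bump` on the window of length `ε`
centred at `r` (`windowMass`), and `a_j = τ_j - j ε + 1/2 - 3/p` (`switchPhase`). The sequence
`τ_j = j - 1/2 + 3/p` is the one with `a_j = j P`, so that each switch gains the maximum `w(0)`.

The separation conditions read `a_{j+1} ≥ a_j + P/2`. Since `w(r) + w(r + P/2) ≤ w(0)`
(`windowMass_pair_le`), additional switches bring nothing: `sum_windowMass_le`. It follows that if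
`τ_1 ≥ 1/2 + 1/p`, then `∫₀ᵗ density` is for every `t` at most its value for the extremal sequence
(`integral_density_le`), and somewhere strictly smaller if the sequences differ
(`exists_integral_density_lt`). As the weight `1/x²` decreases strictly, integration by parts turns
this into the strict inequality of energies.

If `τ_1 < 1/2 + 1/p`, the first switch may bring a small gain near `x = 1/2` that violates the
inequality of partial integrals. Such a switch delays everything after it by `ε`, and what is left
after removing it is a sequence with late first switch (`dropFirst`). So the energy deficit is at
least the loss which the delay causes on the extremal density, minus that gain. Already the first
bump beyond `4/p` loses more than the gain: it is symmetric about `1/2 + 3/p`, and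
`1/x² - 1/(x + ε)²` is bounded below there by convexity (`delay_loss_ge`, `early_gain_lt_loss`).
-/

/-! ### The profile of the density and its windows of length `1 - 4 / p` -/

/-- The `4 / p`-periodic profile `max(0, cos (p π z / 2))²`, with a peak at `z = 0`. -/
noncomputable def bump (p z : ℝ) : ℝ := (max 0 (Real.cos (p / 2 * π * z))) ^ 2

/-- The primitive of `bump p` that vanishes at `0`. -/
noncomputable def bumpInt (p z : ℝ) : ℝ := ∫ u in (0 : ℝ)..z, bump p u

/-- The mass of `bump p` on the window of length `1 - 4 / p` centred at `r`. A switch sets the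
phase back by the length of the window, so this is the mass that is traversed once more. -/
noncomputable def windowMass (p r : ℝ) : ℝ :=
  bumpInt p (r + (1 - 4 / p) / 2) - bumpInt p (r - (1 - 4 / p) / 2)

lemma bump_nonneg (p z : ℝ) : 0 ≤ bump p z := sq_nonneg _

lemma bump_le_one (p z : ℝ) : bump p z ≤ 1 := by
  have h : max 0 (Real.cos (p / 2 * π * z)) ≤ 1 := max_le zero_le_one (Real.cos_le_one _)
  exact pow_le_one₀ (le_max_left _ _) h

lemma continuous_bump (p : ℝ) : Continuous (bump p) := by
  unfold bump
  fun_prop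

lemma bump_neg (p z : ℝ) : bump p (-z) = bump p z := by
  simp [bump]

lemma bump_add_period {p : ℝ} (hp : p ≠ 0) (z : ℝ) : bump p (z + 4 / p) = bump p z := by
  have h : p / 2 * π * (z + 4 / p) = p / 2 * π * z + 2 * π := by field_simp; ring
  simp only [bump, h, Real.cos_add_two_pi]

lemma bump_add_bump_half {p : ℝ} (hp : p ≠ 0) (z : ℝ) :
    bump p z + bump p (z + 2 / p) = Real.cos (p / 2 * π * z) ^ 2 := by
  have h : p / 2 * π * (z + 2 / p) = p / 2 * π * z + π := by field_simp
  simp only [bump, h, Real.cos_add_pi]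
  rcases le_total 0 (Real.cos (p / 2 * π * z)) with h0 | h0
  · rw [max_eq_right h0, max_eq_left (by linarith)]; ring
  · rw [max_eq_left h0, max_eq_right (by linarith)]; ring

lemma bump_eq_cos_sq {p z : ℝ} (hp : 0 < p) (h1 : -(1 / p) ≤ z) (h2 : z ≤ 1 / p) :
    bump p z = Real.cos (p / 2 * π * z) ^ 2 := by
  have hm : 0 < p / 2 * π := by positivity
  have e : p / 2 * π * (1 / p) = π / 2 := by field_simp
  have h3 := mul_le_mul_of_nonneg_left h1 hm.le
  have h4 := mul_le_mul_of_nonneg_left h2 hm.le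
  rw [bump, max_eq_right (Real.cos_nonneg_of_mem_Icc ⟨by linarith, by linarith⟩)]

lemma bump_eq_zero {p z : ℝ} (hp : 0 < p) (h1 : 1 / p ≤ z) (h2 : z ≤ 3 / p) :
    bump p z = 0 := by
  have hm : 0 < p / 2 * π := by positivity
  have e : p / 2 * π * (1 / p) = π / 2 := by field_simp
  have e3 : p / 2 * π * (3 / p) = π + π / 2 := by field_simp; norm_num
  have h3 := mul_le_mul_of_nonneg_left h1 hm.le
  have h4 := mul_le_mul_of_nonneg_left h2 hm.le
  rw [bump, max_eq_left (Real.cos_nonpos_of_pi_div_two_le_of_le (by linarith) (by linarith))]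
  norm_num

lemma intervalIntegrable_bump (p a b : ℝ) : IntervalIntegrable (bump p) volume a b :=
  (continuous_bump p).intervalIntegrable a b

lemma hasDerivAt_bumpInt (p z : ℝ) : HasDerivAt (bumpInt p) (bump p z) z :=
  (continuous_bump p).integral_hasStrictDerivAt 0 z |>.hasDerivAt

lemma bumpInt_sub (p a b : ℝ) : bumpInt p b - bumpInt p a = ∫ u in a..b, bump p u := by
  rw [bumpInt, bumpInt, intervalIntegral.integral_interval_sub_left] <;>
    exact intervalIntegrable_bump p _ _

lemma bumpInt_mono (p : ℝ) : Monotone (bumpInt p) := fun a b hab => by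
  rw [← sub_nonneg, bumpInt_sub]
  exact intervalIntegral.integral_nonneg hab fun u _ => bump_nonneg p u

lemma bumpInt_neg (p z : ℝ) : bumpInt p (-z) = -bumpInt p z := by
  have h := intervalIntegral.integral_comp_neg (a := 0) (b := z) (bump p)
  simp only [bump_neg, neg_zero] at h
  rw [bumpInt, bumpInt, h, intervalIntegral.integral_symm]

lemma bumpInt_sub_shift {p : ℝ} (hp : p ≠ 0) (a b : ℝ) :
    bumpInt p (b + 4 / p) - bumpInt p (a + 4 / p) = bumpInt p b - bumpInt p a := by
  rw [bumpInt_sub, bumpInt_sub, ← intervalIntegral.integral_comp_add_right]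
  simp only [bump_add_period hp]

lemma windowMass_add_period {p : ℝ} (hp : p ≠ 0) (r : ℝ) :
    windowMass p (r + 4 / p) = windowMass p r := by
  rw [windowMass, windowMass, ← bumpInt_sub_shift hp (r - (1 - 4 / p) / 2)]
  congr 2 <;> ring

lemma windowMass_add_nat_mul {p : ℝ} (hp : p ≠ 0) (r : ℝ) (n : ℕ) :
    windowMass p (r + n * (4 / p)) = windowMass p r := by
  induction n with
  | zero => simp
  | succ n ih =>
    rw [← ih, ← windowMass_add_period hp (r + n * (4 / p))]
    congr 1
    push_cast
    ring

lemma windowMass_neg (p r : ℝ) : windowMass p (-r) = windowMass p r := by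
  have h1 : -r + (1 - 4 / p) / 2 = -(r - (1 - 4 / p) / 2) := by ring
  have h2 : -r - (1 - 4 / p) / 2 = -(r + (1 - 4 / p) / 2) := by ring
  rw [windowMass, h1, h2, bumpInt_neg, bumpInt_neg, windowMass]
  ring

lemma integral_cos_mul_sq {m : ℝ} (hm : m ≠ 0) (a b : ℝ) :
    ∫ z in a..b, Real.cos (m * z) ^ 2 =
      (b - a) / 2 + (Real.sin (2 * (m * b)) - Real.sin (2 * (m * a))) / (4 * m) := by
  have h : ∀ z ∈ uIcc a b, HasDerivAt
      (fun z => z / 2 + Real.sin (2 * (m * z)) / (4 * m)) (Real.cos (m * z) ^ 2) z := by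
    intro z _
    have h1 : HasDerivAt (fun z : ℝ => 2 * (m * z)) (2 * (m * 1)) z :=
      ((hasDerivAt_id z).const_mul m).const_mul 2
    refine (((hasDerivAt_id z).div_const 2).add (h1.sin.div_const (4 * m))).congr_deriv ?_
    rw [Real.cos_two_mul]
    field_simp
    ring
  rw [intervalIntegral.integral_eq_sub_of_hasDerivAt h
    ((by fun_prop : Continuous fun z => Real.cos (m * z) ^ 2).intervalIntegrable _ _)]
  ring

section
variable {p : ℝ}

lemma one_div_bounds (hp : 4 < p) (hp' : p ≤ 5) : 1 / 5 ≤ 1 / p ∧ 1 / p < 1 / 4 :=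
  ⟨one_div_le_one_div_of_le (by linarith) hp', one_div_lt_one_div_of_lt (by norm_num) hp⟩

lemma windowMass_nonneg (hp : 4 < p) (r : ℝ) : 0 ≤ windowMass p r := by
  rw [windowMass, sub_nonneg]
  apply bumpInt_mono
  have : 4 / p < 1 := by rw [div_lt_one (by linarith)]; exact hp
  linarith

/-- Two windows half a period apart together see the full `cos²`, since `bump` and its translate
by half a period add up to it. -/
lemma windowMass_pair (hp : 4 < p) (r : ℝ) :
    windowMass p r + windowMass p (r + 2 / p) = (1 - 4 / p) / 2 +
      Real.sin (p / 2 * π * (1 - 4 / p)) * Real.cos (2 * (p / 2 * π * r)) / (2 * (p / 2 * π)) := by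
  have hp0 : p ≠ 0 := by linarith
  have hm : p / 2 * π ≠ 0 := by positivity
  have h : windowMass p (r + 2 / p) =
      ∫ u in (r - (1 - 4 / p) / 2)..(r + (1 - 4 / p) / 2), bump p (u + 2 / p) := by
    rw [intervalIntegral.integral_comp_add_right, windowMass, bumpInt_sub]
    congr 1 <;> ring
  have hc : Continuous fun u => bump p (u + 2 / p) :=
    (continuous_bump p).comp (continuous_add_const _)
  rw [h, windowMass, bumpInt_sub, ← intervalIntegral.integral_add
    (intervalIntegrable_bump _ _ _) (hc.intervalIntegrable _ _)]
  simp only [bump_add_bump_half hp0]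
  rw [integral_cos_mul_sq hm, Real.sin_sub_sin]
  have e1 : (2 * (p / 2 * π * (r + (1 - 4 / p) / 2)) - 2 * (p / 2 * π * (r - (1 - 4 / p) / 2))) / 2
    = p / 2 * π * (1 - 4 / p) := by ring
  have e2 : (2 * (p / 2 * π * (r + (1 - 4 / p) / 2)) + 2 * (p / 2 * π * (r - (1 - 4 / p) / 2))) / 2
    = 2 * (p / 2 * π * r) := by ring
  rw [e1, e2]
  field_simp
  ring

/-- The window about the trough `2 / p` lies where the cosine is nonpositive. -/
lemma windowMass_half (hp : 4 < p) (hp' : p ≤ 5) : windowMass p (2 / p) = 0 := by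
  obtain ⟨h5, h4⟩ := one_div_bounds hp hp'
  have e4 : 4 / p = 4 * (1 / p) := by ring
  have e2 : 2 / p = 2 * (1 / p) := by ring
  have e3 : 3 / p = 3 * (1 / p) := by ring
  rw [windowMass, bumpInt_sub, intervalIntegral.integral_congr (g := fun _ => 0)]
  · simp
  · intro z hz
    rw [uIcc_of_le (by linarith)] at hz
    exact bump_eq_zero (by linarith) (by linarith [hz.1]) (by linarith [hz.2])

lemma sin_phase_pos (hp : 4 < p) (hp' : p ≤ 5) : 0 < Real.sin (p / 2 * π * (1 - 4 / p)) := by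
  have e : p / 2 * π * (1 - 4 / p) = π * ((p - 4) / 2) := by field_simp
  rw [e]
  apply Real.sin_pos_of_pos_of_lt_pi
  · have := Real.pi_pos
    have : 0 < p - 4 := by linarith
    positivity
  · nlinarith [Real.pi_pos]

lemma windowMass_zero (hp : 4 < p) (hp' : p ≤ 5) :
    windowMass p 0 = (1 - 4 / p) / 2 +
      Real.sin (p / 2 * π * (1 - 4 / p)) / (2 * (p / 2 * π)) := by
  have h := windowMass_pair hp 0
  rw [zero_add, windowMass_half hp hp'] at h
  simpa using h

lemma windowMass_pair_le (hp : 4 < p) (hp' : p ≤ 5) (r : ℝ) :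
    windowMass p r + windowMass p (r + 2 / p) ≤ windowMass p 0 := by
  rw [windowMass_pair hp, windowMass_zero hp hp']
  have := sin_phase_pos hp hp'
  have : Real.cos (2 * (p / 2 * π * r)) ≤ 1 := Real.cos_le_one _
  gcongr
  nlinarith

lemma windowMass_le (hp : 4 < p) (hp' : p ≤ 5) (r : ℝ) : windowMass p r ≤ windowMass p 0 := by
  linarith [windowMass_pair_le hp hp' r, windowMass_nonneg hp (r + 2 / p)]

lemma windowMass_zero_pos (hp : 4 < p) (hp' : p ≤ 5) : 0 < windowMass p 0 := by
  rw [windowMass_zero hp hp']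
  have h := sin_phase_pos hp hp'
  have : 4 / p < 1 := by rw [div_lt_one (by linarith)]; exact hp
  have : 0 < 1 - 4 / p := by linarith
  positivity

lemma windowMass_lt (hp : 4 < p) (hp' : p ≤ 5) {r : ℝ} (h1 : 0 < r) (h2 : r ≤ 2 / p) :
    windowMass p r < windowMass p 0 := by
  rcases h2.eq_or_lt with rfl | h2
  · rw [windowMass_half hp hp']
    exact windowMass_zero_pos hp hp'
  have hpair : windowMass p r + windowMass p (r + 2 / p) < windowMass p 0 := by
    rw [windowMass_pair hp, windowMass_zero hp hp']
    have := sin_phase_pos hp hp'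
    have hm : 0 < p / 2 * π := by positivity
    have h3 := mul_lt_mul_of_pos_left h2 hm
    have e : p / 2 * π * (2 / p) = π := by field_simp
    have : Real.cos (2 * (p / 2 * π * r)) < 1 := by
      have hs : 0 < Real.sin (p / 2 * π * r) :=
        Real.sin_pos_of_pos_of_lt_pi (by positivity) (by linarith)
      rw [Real.cos_two_mul, Real.cos_sq']
      nlinarith
    gcongr
    nlinarith
  linarith [windowMass_nonneg hp (r + 2 / p)]

lemma hasDerivAt_windowMass (p r : ℝ) : HasDerivAt (windowMass p)
    (bump p (r + (1 - 4 / p) / 2) - bump p (r - (1 - 4 / p) / 2)) r :=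
  ((hasDerivAt_bumpInt p _).comp_add_const r _).sub ((hasDerivAt_bumpInt p _).comp_sub_const r _)

lemma windowMass_monotoneOn (hp : 4 < p) (hp' : p ≤ 5) :
    MonotoneOn (windowMass p) (Icc (-(2 / p)) 0) := by
  apply monotoneOn_of_deriv_nonneg (convex_Icc _ _)
  · exact fun r _ => (hasDerivAt_windowMass p r).continuousAt.continuousWithinAt
  · exact fun r _ => (hasDerivAt_windowMass p r).differentiableAt.differentiableWithinAt
  · intro r hr
    rw [interior_Icc] at hr
    rw [(hasDerivAt_windowMass p r).deriv, sub_nonneg, bump, bump]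
    apply pow_le_pow_left₀ (le_max_left _ _)
    apply max_le_max le_rfl
    rw [← sub_nonneg, Real.cos_sub_cos]
    have e1 : (p / 2 * π * (r + (1 - 4 / p) / 2) + p / 2 * π * (r - (1 - 4 / p) / 2)) / 2
      = p / 2 * π * r := by ring
    have e2 : (p / 2 * π * (r + (1 - 4 / p) / 2) - p / 2 * π * (r - (1 - 4 / p) / 2)) / 2
      = π * ((p - 4) / 4) := by field_simp; ring
    rw [e1, e2]
    have hm : 0 < p / 2 * π := by positivity
    have h3 := mul_lt_mul_of_pos_left hr.1 hm
    have e : p / 2 * π * -(2 / p) = -π := by field_simp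
    have hs1 : Real.sin (p / 2 * π * r) ≤ 0 :=
      Real.sin_nonpos_of_nonpos_of_neg_pi_le (by nlinarith [hr.2]) (by linarith)
    have hs2 : 0 ≤ Real.sin (π * ((p - 4) / 4)) :=
      Real.sin_nonneg_of_nonneg_of_le_pi (by nlinarith [Real.pi_pos]) (by nlinarith [Real.pi_pos])
    nlinarith

/-- On the second half of the `m`-th period, running from a trough to a peak, the window mass
increases. -/
lemma windowMass_mono_cell (hp : 4 < p) (hp' : p ≤ 5) (m : ℕ) {x y : ℝ}
    (hx : ((m : ℝ) + 1 / 2) * (4 / p) ≤ x) (hxy : x ≤ y) (hy : y ≤ ((m : ℝ) + 1) * (4 / p)) :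
    windowMass p x ≤ windowMass p y := by
  have hp0 : p ≠ 0 := by linarith
  have e2 : 2 / p = 1 / 2 * (4 / p) := by ring
  have key : ∀ z, windowMass p (z - (m + 1 : ℕ) * (4 / p)) = windowMass p z := fun z => by
    rw [← windowMass_add_nat_mul hp0 _ (m + 1), sub_add_cancel]
  rw [← key x, ← key y]
  apply windowMass_monotoneOn hp hp'
  · constructor <;> push_cast <;> linarith
  · constructor <;> push_cast <;> linarith
  · linarith

/-- Switches whose phases are at least half a period apart, the first one at least half a period
after `0`, gain no more than one maximal window per period. The last term accounts for a switch
in the rising half of a period that has not been completed. -/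
lemma sum_windowMass_le (hp : 4 < p) (hp' : p ≤ 5) (a : ℕ → ℝ) (h1 : ∀ n, 2 / p ≤ a (n + 1))
    (hstep : ∀ n, a n + 2 / p ≤ a (n + 1)) (n m : ℕ) (x : ℝ) (hax : a n ≤ x)
    (hx : x ≤ ((m : ℝ) + 1) * (4 / p)) :
    ∑ j ∈ Finset.range n, windowMass p (a (j + 1)) ≤ m * windowMass p 0 + windowMass p x := by
  have hp0 : p ≠ 0 := by linarith
  have hP : 0 < 4 / p := by positivity
  have e2 : 2 / p = 1 / 2 * (4 / p) := by ring
  have hA := (windowMass_zero_pos hp hp').le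
  induction n generalizing m x with
  | zero =>
    have := windowMass_nonneg hp x
    simp only [Finset.range_zero, Finset.sum_empty]
    positivity
  | succ n ih =>
    rw [Finset.sum_range_succ]
    have hs := hstep n
    -- Either the last switch lies in the rising half of the last period and is paid for by
    -- `windowMass p x`, or it is paired with the earlier ones at a distance of half a period.
    by_cases hc : ((m : ℝ) + 1 / 2) * (4 / p) ≤ a (n + 1)
    · have h2 := windowMass_mono_cell hp hp' m hc hax hx
      have h3 := ih m (((m : ℝ) + 1 / 2) * (4 / p)) (by linarith) (by nlinarith)
      have h4 : windowMass p (((m : ℝ) + 1 / 2) * (4 / p)) = 0 := by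
        rw [← windowMass_half hp hp', ← windowMass_add_nat_mul hp0 (2 / p) m]
        congr 1
        ring
      linarith
    · push Not at hc
      obtain _ | m := m
      · have := h1 n
        push_cast at hc
        linarith
      · push_cast at hc
        have h3 := ih m (a (n + 1) - 2 / p) (by linarith) (by linarith)
        have h4 := windowMass_pair_le hp hp' (a (n + 1) - 2 / p)
        rw [sub_add_cancel] at h4
        have := windowMass_nonneg hp x
        push_cast
        linarith

/-- An interval made up of `j` windows carries at most `j` maximal window masses. -/
lemma bumpInt_add_le (hp : 4 < p) (hp' : p ≤ 5) (s : ℝ) (j : ℕ) :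
    bumpInt p (s + j * (1 - 4 / p)) - bumpInt p s ≤ j * windowMass p 0 := by
  induction j with
  | zero => simp
  | succ j ih =>
    have h := windowMass_le hp hp' (s + j * (1 - 4 / p) + (1 - 4 / p) / 2)
    rw [windowMass] at h
    have e1 : s + j * (1 - 4 / p) + (1 - 4 / p) / 2 + (1 - 4 / p) / 2
      = s + (j + 1 : ℕ) * (1 - 4 / p) := by push_cast; ring
    have e2 : s + j * (1 - 4 / p) + (1 - 4 / p) / 2 - (1 - 4 / p) / 2 = s + j * (1 - 4 / p) := by
      ring
    rw [e1, e2] at h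
    push_cast at *
    linarith

end

/-! ### The accumulated mass of an admissible sequence -/

/-- The number of switching times `τ 1, τ 2, …` in `(0, x]`. The infimum is over a nonempty set
as soon as `τ` is unbounded; for `x < τ 1`, negative `x` included, it is `0`. -/
noncomputable def switchCount (τ : ℕ → ℝ) (x : ℝ) : ℕ := sInf {n : ℕ | x < τ (n + 1)}

/-- The integrand of `E_p(τ)` without its weight `1 / (π x)²`, made right-continuous at the
switching times. -/
noncomputable def density (p : ℝ) (τ : ℕ → ℝ) (x : ℝ) : ℝ := bump p (x - switchCount τ x - 1 / p)

/-- The phase of the `n`-th switch: the centre of the window traversed twice because of it,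
counted so that the phases reached before and after the switch lie in the same period. -/
noncomputable def switchPhase (p : ℝ) (τ : ℕ → ℝ) (n : ℕ) : ℝ :=
  τ n - n * (1 - 4 / p) + 1 / 2 - 3 / p

/-- The extremal sequence: `0` followed by `n - 1/2 + 3/p` for `n ≥ 1`. -/
noncomputable def optSeq (p : ℝ) (n : ℕ) : ℝ := if n = 0 then 0 else n - 1 / 2 + 3 / p

/-- Sequences starting at `0` with all gaps at least `1/2`. This covers every admissible sequence
and is all that is needed for the analytic properties of the density. -/
def HalfSeparated (τ : ℕ → ℝ) : Prop := τ 0 = 0 ∧ ∀ n, τ n + 1 / 2 ≤ τ (n + 1)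

namespace HalfSeparated
lemma strictMono {τ : ℕ → ℝ} (hτ : HalfSeparated τ)
    : StrictMono τ := strictMono_nat_of_lt_succ fun n => by linarith [hτ.2 n]

lemma half_le {τ : ℕ → ℝ} (hτ : HalfSeparated τ) (n : ℕ) : (n : ℝ) / 2 ≤ τ n := by
  induction n with
  | zero => simp [hτ.1]
  | succ n ih =>
    have := hτ.2 n
    push_cast
    linarith

lemma exists_lt {τ : ℕ → ℝ} (hτ : HalfSeparated τ) (x : ℝ) : {n : ℕ | x < τ (n + 1)}.Nonempty := by
  obtain ⟨n, hn⟩ := exists_nat_gt (2 * x)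
  refine ⟨n, ?_⟩
  have := hτ.half_le (n + 1)
  push_cast at this
  simp only [mem_ofPred_eq]
  linarith

lemma lt_switchCount {τ : ℕ → ℝ} (hτ : HalfSeparated τ)
    (x : ℝ) : x < τ (switchCount τ x + 1) := Nat.sInf_mem (hτ.exists_lt x)

lemma switchCount_le {τ : ℕ → ℝ} (hτ : HalfSeparated τ)
    {x : ℝ} (hx : 0 ≤ x) : τ (switchCount τ x) ≤ x := by
  rcases h : switchCount τ x with _ | n
  · rwa [hτ.1]
  · by_contra! hlt
    have : switchCount τ x ≤ n := Nat.sInf_le hlt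
    omega

lemma switchCount_eq {τ : ℕ → ℝ} (hτ : HalfSeparated τ)
    {x : ℝ} {n : ℕ} (h1 : τ n ≤ x) (h2 : x < τ (n + 1)) :
    switchCount τ x = n := by
  apply le_antisymm (Nat.sInf_le h2)
  by_contra! hlt
  have := hτ.lt_switchCount x
  have := hτ.strictMono.monotone (show switchCount τ x + 1 ≤ n from hlt)
  linarith

lemma switchCount_mono {τ : ℕ → ℝ} (hτ : HalfSeparated τ)
    : Monotone (switchCount τ) := fun _ y hxy =>
  Nat.sInf_le (lt_of_le_of_lt hxy (hτ.lt_switchCount y))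

lemma measurable_density {τ : ℕ → ℝ} (hτ : HalfSeparated τ) (p : ℝ) : Measurable (density p τ) := by
  have : Measurable fun x => (switchCount τ x : ℝ) :=
    (Nat.mono_cast.comp hτ.switchCount_mono).measurable
  exact (continuous_bump p).measurable.comp ((measurable_id.sub this).sub_const _)

lemma density_eq {τ : ℕ → ℝ} (hτ : HalfSeparated τ)
    {p x : ℝ} {n : ℕ} (h1 : τ n ≤ x) (h2 : x < τ (n + 1)) :
    density p τ x = bump p (x - n - 1 / p) := by
  rw [density, hτ.switchCount_eq h1 h2]

end HalfSeparated

lemma switchCount_of_lt {τ : ℕ → ℝ} {x : ℝ} (h : x < τ 1) : switchCount τ x = 0 :=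
  Nat.le_zero.1 (Nat.sInf_le (by simpa using h))

lemma density_nonneg (p : ℝ) (τ : ℕ → ℝ) (x : ℝ) : 0 ≤ density p τ x := bump_nonneg _ _

lemma density_le_one (p : ℝ) (τ : ℕ → ℝ) (x : ℝ) : density p τ x ≤ 1 := bump_le_one _ _

namespace HalfSeparated
lemma intervalIntegrable_density {τ : ℕ → ℝ} (hτ : HalfSeparated τ)
    (p a b : ℝ) : IntervalIntegrable (density p τ) volume a b := by
  refine (intervalIntegrable_const (c := (1 : ℝ))).mono_fun
    (hτ.measurable_density p).aestronglyMeasurable (Filter.Eventually.of_forall fun x => ?_)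
  simp only [Real.norm_of_nonneg (density_nonneg _ _ _), norm_one]
  exact density_le_one _ _ _

lemma continuousWithinAt_density {τ : ℕ → ℝ} (hτ : HalfSeparated τ) (p : ℝ) {x : ℝ} (hx : 0 ≤ x) :
    ContinuousWithinAt (density p τ) (Ioi x) x := by
  have hc : Continuous fun y => bump p (y - switchCount τ x - 1 / p) :=
    (continuous_bump p).comp (by fun_prop)
  refine hc.continuousWithinAt.congr_of_eventuallyEq ?_ rfl
  have : Ioo x (τ (switchCount τ x + 1)) ∈ nhdsWithin x (Ioi x) :=
    Ioo_mem_nhdsGT (hτ.lt_switchCount x)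
  filter_upwards [this] with y hy
  exact hτ.density_eq ((hτ.switchCount_le hx).trans hy.1.le) hy.2

lemma hasDerivWithinAt_integral_density {τ : ℕ → ℝ} (hτ : HalfSeparated τ)
    (p : ℝ) {x : ℝ} (hx : 0 ≤ x) :
    HasDerivWithinAt (fun t => ∫ y in (0 : ℝ)..t, density p τ y) (density p τ x) (Ioi x) x :=
  (intervalIntegral.integral_hasDerivWithinAt_right (hτ.intervalIntegrable_density p 0 x)
    (s := Ici x) (t := Ioi x)
    (hτ.measurable_density p).stronglyMeasurable.stronglyMeasurableAtFilter
    (hτ.continuousWithinAt_density p hx)).mono Ioi_subset_Ici_self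

lemma continuous_integral_density {τ : ℕ → ℝ} (hτ : HalfSeparated τ) (p : ℝ) :
    Continuous fun t => ∫ y in (0 : ℝ)..t, density p τ y :=
  intervalIntegral.continuous_primitive (fun a b => hτ.intervalIntegrable_density p a b) 0

lemma integral_density_piece {τ : ℕ → ℝ} (hτ : HalfSeparated τ)
    (p : ℝ) {n : ℕ} {s t : ℝ} (hs : τ n ≤ s) (hst : s ≤ t)
    (ht : t ≤ τ (n + 1)) :
    ∫ y in s..t, density p τ y = bumpInt p (t - n - 1 / p) - bumpInt p (s - n - 1 / p) := by
  have h : ∫ y in s..t, density p τ y = ∫ y in s..t, bump p (y - (n + 1 / p)) := by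
    apply intervalIntegral.integral_congr_ae
    filter_upwards [compl_mem_ae_iff.2 (measure_singleton t)] with y hy hy'
    rw [uIoc_of_le hst] at hy'
    rw [hτ.density_eq (hs.trans hy'.1.le) ((lt_of_le_of_ne hy'.2 hy).trans_le ht), sub_sub]
  rw [h, intervalIntegral.integral_comp_sub_right, bumpInt_sub, sub_sub, sub_sub]

/-- The mass accumulated up to `t` after `n` switches: what a phase moving without interruption
to `t - n (1 - 4 / p) - 1 / p` collects, plus one window per switch. -/
lemma integral_density {τ : ℕ → ℝ} (hτ : HalfSeparated τ)
    {p : ℝ} (hp : p ≠ 0) (n : ℕ) (t : ℝ) (h1 : τ n ≤ t) (h2 : t ≤ τ (n + 1)) :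
    ∫ y in (0 : ℝ)..t, density p τ y =
      bumpInt p (t - n * (1 - 4 / p) - 1 / p) - bumpInt p (-(1 / p)) +
        ∑ j ∈ Finset.range n, windowMass p (switchPhase p τ (j + 1)) := by
  have hshift : ∀ (m : ℕ) (a b : ℝ), bumpInt p (b + m * (4 / p)) - bumpInt p (a + m * (4 / p)) =
      bumpInt p b - bumpInt p a := by
    intro m a b
    induction m with
    | zero => simp
    | succ m ih =>
      rw [← ih, ← bumpInt_sub_shift hp (a + m * (4 / p))]
      congr 2 <;> push_cast <;> ring
  induction n generalizing t with
  | zero =>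
    rw [hτ.integral_density_piece p hτ.1.le (by rwa [← hτ.1]) h2]
    simp
  | succ n ih =>
    rw [← intervalIntegral.integral_add_adjacent_intervals
      (hτ.intervalIntegrable_density p 0 (τ (n + 1))) (hτ.intervalIntegrable_density p _ t),
      ih _ (hτ.strictMono.monotone n.le_succ) le_rfl, hτ.integral_density_piece p le_rfl h1 h2,
      Finset.sum_range_succ, windowMass, switchPhase,
      ← hshift (n + 1) (τ (n + 1) - (n + 1 : ℕ) - 1 / p)]
    have e1 : τ (n + 1) - (n + 1 : ℕ) * (1 - 4 / p) + 1 / 2 - 3 / p + (1 - 4 / p) / 2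
      = τ (n + 1) - n * (1 - 4 / p) - 1 / p := by push_cast; ring
    have e2 : τ (n + 1) - (n + 1 : ℕ) * (1 - 4 / p) + 1 / 2 - 3 / p - (1 - 4 / p) / 2
      = τ (n + 1) - (n + 1 : ℕ) - 1 / p + (n + 1 : ℕ) * (4 / p) := by push_cast; ring
    have e3 : t - (n + 1 : ℕ) - 1 / p + (n + 1 : ℕ) * (4 / p)
      = t - (n + 1 : ℕ) * (1 - 4 / p) - 1 / p := by push_cast; ring
    rw [e1, e2, e3]
    ring

end HalfSeparated

section
variable {p : ℝ}

lemma halfSeparated_of_mem (hp : 4 < p) {τ : ℕ → ℝ} (hτ : τ ∈ sepSeq (1 / 2) (1 - 2 / p)) :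
    HalfSeparated τ := by
  obtain ⟨h0, h1, h⟩ := hτ
  refine ⟨h0, fun n => ?_⟩
  have : 2 / p < 1 / 2 := by rw [div_lt_div_iff₀] <;> linarith
  rcases n with _ | n
  · rw [h0]; linarith
  · have := h (n + 1) (by omega)
    linarith

lemma optSeq_succ (p : ℝ) (n : ℕ) : optSeq p (n + 1) = n + 1 / 2 + 3 / p := by
  rw [optSeq, if_neg n.succ_ne_zero]
  push_cast
  ring

lemma optSeq_halfSeparated (hp : 4 < p) : HalfSeparated (optSeq p) := by
  refine ⟨by simp [optSeq], fun n => ?_⟩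
  rcases n with _ | n
  · rw [optSeq_succ]
    have : 0 < 3 / p := by positivity
    simp [optSeq]
    positivity
  · rw [optSeq_succ, optSeq_succ]
    push_cast
    linarith

lemma switchPhase_optSeq (p : ℝ) (n : ℕ) :
    switchPhase p (optSeq p) (n + 1) = 0 + (n + 1 : ℕ) * (4 / p) := by
  rw [switchPhase, optSeq_succ]
  push_cast
  ring

lemma integral_density_optSeq (hp : 4 < p) {t : ℝ} {m : ℕ} (h1 : optSeq p m ≤ t)
    (h2 : t ≤ optSeq p (m + 1)) :
    ∫ y in (0 : ℝ)..t, density p (optSeq p) y =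
      bumpInt p (t - m * (1 - 4 / p) - 1 / p) - bumpInt p (-(1 / p)) + m * windowMass p 0 := by
  have hp0 : p ≠ 0 := by linarith
  rw [(optSeq_halfSeparated hp).integral_density hp0 m t h1 h2]
  congr 1
  simp only [switchPhase_optSeq, windowMass_add_nat_mul hp0]
  simp

lemma switchPhase_step {τ : ℕ → ℝ} (hp : 4 < p) (hp' : p ≤ 5)
    (hτ : τ ∈ sepSeq (1 / 2) (1 - 2 / p)) (h1 : 1 / 2 + 1 / p ≤ τ 1) (n : ℕ) :
    switchPhase p τ n + 2 / p ≤ switchPhase p τ (n + 1) := by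
  obtain ⟨h5, h4⟩ := one_div_bounds hp hp'
  have e4 : 4 / p = 4 * (1 / p) := by ring
  have e2 : 2 / p = 2 * (1 / p) := by ring
  have e3 : 3 / p = 3 * (1 / p) := by ring
  rw [switchPhase, switchPhase]
  rcases n with _ | n
  · rw [hτ.1]
    push_cast
    linarith
  · have := hτ.2.2 (n + 1) (by omega)
    push_cast
    linarith

lemma le_switchPhase {τ : ℕ → ℝ} (hp : 4 < p) (hp' : p ≤ 5)
    (hτ : τ ∈ sepSeq (1 / 2) (1 - 2 / p)) (h1 : 1 / 2 + 1 / p ≤ τ 1) (n : ℕ) :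
    ((n : ℝ) + 1) * (2 / p) ≤ switchPhase p τ (n + 1) := by
  induction n with
  | zero =>
    rw [switchPhase]
    have e4 : 4 / p = 4 * (1 / p) := by ring
    have e2 : 2 / p = 2 * (1 / p) := by ring
    have e3 : 3 / p = 3 * (1 / p) := by ring
    push_cast
    linarith
  | succ n ih =>
    have := switchPhase_step hp hp' hτ h1 (n + 1)
    push_cast
    linarith

/-- If the first switch is late, no sequence is ahead of the extremal one at any time. With fewer
switches than the extremal sequence this is the maximality of the windows, with more switches it
is `sum_windowMass_le`. -/
lemma integral_density_le {τ : ℕ → ℝ} (hp : 4 < p) (hp' : p ≤ 5)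
    (hτ : τ ∈ sepSeq (1 / 2) (1 - 2 / p)) (h1 : 1 / 2 + 1 / p ≤ τ 1) {t : ℝ} (ht : 0 ≤ t) :
    ∫ y in (0 : ℝ)..t, density p τ y ≤ ∫ y in (0 : ℝ)..t, density p (optSeq p) y := by
  have hp0 : p ≠ 0 := by linarith
  have hε : 0 < 1 - 4 / p := by
    have : 4 / p < 1 := by rw [div_lt_one (by linarith)]; exact hp
    linarith
  have hs := halfSeparated_of_mem hp hτ
  have ho := optSeq_halfSeparated hp
  set n := switchCount τ t with hn
  set m := switchCount (optSeq p) t with hm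
  have hm2 : t < optSeq p (m + 1) := ho.lt_switchCount t
  have hn1 : τ n ≤ t := hs.switchCount_le ht
  rw [hs.integral_density hp0 n t hn1 (hs.lt_switchCount t).le,
    integral_density_optSeq hp (ho.switchCount_le ht) hm2.le]
  rcases le_or_gt n m with hnm | hnm
  · have hsum : ∑ j ∈ Finset.range n, windowMass p (switchPhase p τ (j + 1)) ≤
        n * windowMass p 0 := by
      refine (Finset.sum_le_card_nsmul _ _ _ fun j _ => windowMass_le hp hp' _).trans ?_
      simp
    obtain ⟨d, hd⟩ := Nat.exists_eq_add_of_le hnm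
    have h2 := bumpInt_add_le hp hp' (t - m * (1 - 4 / p) - 1 / p) d
    have e : t - m * (1 - 4 / p) - 1 / p + d * (1 - 4 / p) = t - n * (1 - 4 / p) - 1 / p := by
      rw [hd]; push_cast; ring
    rw [e] at h2
    have e2 : (m : ℝ) * windowMass p 0 = n * windowMass p 0 + d * windowMass p 0 := by
      rw [hd]; push_cast; ring
    linarith
  · have hnm' : (m : ℝ) + 1 ≤ n := by exact_mod_cast hnm
    rw [optSeq_succ] at hm2
    have hS := sum_windowMass_le hp hp' (switchPhase p τ)
      (fun j => by
        have h3 := le_switchPhase hp hp' hτ h1 j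
        have : 0 < 2 / p := by positivity
        nlinarith [(Nat.cast_nonneg j : (0 : ℝ) ≤ j)])
      (switchPhase_step hp hp' hτ h1) n m (t - n * (1 - 4 / p) + 1 / 2 - 3 / p)
      (by rw [switchPhase]; linarith) (by nlinarith)
    have e1 : t - n * (1 - 4 / p) + 1 / 2 - 3 / p - (1 - 4 / p) / 2
      = t - n * (1 - 4 / p) - 1 / p := by ring
    rw [windowMass.eq_1 p (t - n * (1 - 4 / p) + 1 / 2 - 3 / p), e1] at hS
    have h3 : bumpInt p (t - n * (1 - 4 / p) + 1 / 2 - 3 / p + (1 - 4 / p) / 2) ≤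
        bumpInt p (t - m * (1 - 4 / p) - 1 / p) := by
      apply bumpInt_mono
      have e3 : t - n * (1 - 4 / p) + 1 / 2 - 3 / p + (1 - 4 / p) / 2
        = t - n * (1 - 4 / p) - 1 / p + (1 - 4 / p) := by ring
      nlinarith
    linarith

/-- Strictness: look at the first index where the sequences differ, and compare at (or just
after) the corresponding switch of the extremal sequence. -/
lemma exists_integral_density_lt {τ : ℕ → ℝ} (hp : 4 < p) (hp' : p ≤ 5)
    (hτ : τ ∈ sepSeq (1 / 2) (1 - 2 / p)) (h1 : 1 / 2 + 1 / p ≤ τ 1) (hne : τ ≠ optSeq p) :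
    ∃ t, 1 / 2 ≤ t ∧
      ∫ y in (0 : ℝ)..t, density p τ y < ∫ y in (0 : ℝ)..t, density p (optSeq p) y := by
  classical
  have hp0 : p ≠ 0 := by linarith
  have hP : 0 < 4 / p := by positivity
  have e2 : 2 / p = 1 / 2 * (4 / p) := by ring
  have e3 : 3 / p = 3 / 4 * (4 / p) := by ring
  have hε : 0 < 1 - 4 / p := by
    have : 4 / p < 1 := by rw [div_lt_one (by linarith)]; exact hp
    linarith
  have hs := halfSeparated_of_mem hp hτ
  have ho := optSeq_halfSeparated hp
  obtain ⟨k, hk⟩ := Function.ne_iff.1 hne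
  have hex : ∃ k, τ k ≠ optSeq p k := ⟨k, hk⟩
  obtain ⟨n, hn⟩ : ∃ n, Nat.find hex = n + 1 := by
    refine Nat.exists_eq_succ_of_ne_zero fun h => Nat.find_spec hex ?_
    rw [h, hs.1, ho.1]
  have hdiff : τ (n + 1) ≠ optSeq p (n + 1) := hn ▸ Nat.find_spec hex
  have hsame : ∀ j ≤ n, τ j = optSeq p j := fun j hj =>
    not_not.1 (Nat.find_min hex (by omega))
  have hsum : ∑ j ∈ Finset.range n, windowMass p (switchPhase p τ (j + 1)) =
      n * windowMass p 0 := by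
    have : ∀ j ∈ Finset.range n, windowMass p (switchPhase p τ (j + 1)) = windowMass p 0 := by
      intro j hj
      rw [switchPhase, hsame (j + 1) (Finset.mem_range.1 hj), ← switchPhase,
        switchPhase_optSeq, windowMass_add_nat_mul hp0]
    rw [Finset.sum_congr rfl this]
    simp
  have ho1 := optSeq_succ p n
  have ho2 := optSeq_succ p (n + 1)
  push_cast at ho2
  rcases lt_or_gt_of_ne hdiff with hlt | hgt
  · refine ⟨optSeq p (n + 1), ?_, ?_⟩
    · have : (0 : ℝ) ≤ n := Nat.cast_nonneg n
      linarith
    have hphase : switchPhase p τ (n + 1) =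
        τ (n + 1) - optSeq p (n + 1) + (n + 1 : ℕ) * (4 / p) := by
      rw [switchPhase, ho1]
      push_cast
      ring
    have hcell : ((n : ℝ) + 1 / 2) * (4 / p) ≤ switchPhase p τ (n + 1) := by
      rcases n with _ | n
      · have := le_switchPhase hp hp' hτ h1 0
        push_cast at *
        linarith
      · have h3 := switchPhase_step hp hp' hτ h1 (n + 1)
        rw [switchPhase, hsame (n + 1) le_rfl, ← switchPhase, switchPhase_optSeq] at h3
        push_cast at *
        linarith
    have hnext : optSeq p (n + 1) ≤ τ (n + 1 + 1) := by
      have h3 := hτ.2.2 (n + 1) (by omega)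
      push_cast at hphase
      have : 4 / p < 1 := by linarith
      linarith
    rw [hs.integral_density hp0 (n + 1) _ hlt.le hnext,
      integral_density_optSeq hp le_rfl (ho.strictMono.monotone (n + 1).le_succ),
      Finset.sum_range_succ, hsum]
    have hw : windowMass p (switchPhase p τ (n + 1)) < windowMass p 0 := by
      rw [hphase, windowMass_add_nat_mul hp0, ← windowMass_neg]
      push_cast at hphase
      exact windowMass_lt hp hp' (by linarith) (by linarith)
    push_cast
    linarith
  · obtain ⟨t, ht1, ht2⟩ : ∃ t, optSeq p (n + 1) < t ∧
        t < min (τ (n + 1)) (optSeq p (n + 1) + 2 / p) := by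
      apply exists_between
      exact lt_min hgt (by linarith)
    obtain ⟨ht2, ht3⟩ := lt_min_iff.1 ht2
    refine ⟨t, ?_, ?_⟩
    · have : (0 : ℝ) ≤ n := Nat.cast_nonneg n
      linarith
    have hb : τ n ≤ t := by
      rw [hsame n le_rfl]
      exact ((ho.strictMono.monotone n.le_succ).trans ht1.le)
    rw [hs.integral_density hp0 n t hb ht2.le,
      integral_density_optSeq hp ht1.le (by linarith), hsum]
    have hw := windowMass_lt hp hp' (r := t - optSeq p (n + 1)) (by linarith) (by linarith)
    rw [← windowMass_add_nat_mul hp0 _ (n + 1), windowMass] at hw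
    have e5 : t - optSeq p (n + 1) + (n + 1 : ℕ) * (4 / p) + (1 - 4 / p) / 2
      = t - n * (1 - 4 / p) - 1 / p := by rw [ho1]; push_cast; ring
    have e6 : t - optSeq p (n + 1) + (n + 1 : ℕ) * (4 / p) - (1 - 4 / p) / 2
      = t - (n + 1 : ℕ) * (1 - 4 / p) - 1 / p := by rw [ho1]; push_cast; ring
    rw [e5, e6] at hw
    push_cast at hw ⊢
    linarith

end

/-! ### Comparison of energies when the first switch is late -/

lemma kernelK_eq {p : ℝ} {τ : ℕ → ℝ} (hτ : HalfSeparated τ) {x : ℝ} {n : ℕ}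
    (h1 : τ n < x) (h2 : x < τ (n + 1)) :
    kernelK p τ x = Real.sin (p / 2 * π * (x - n)) / (π * x) := by
  rw [kernelK, tsum_eq_single n]
  · rw [indicator_of_mem (show x ∈ Ioo (τ n) (τ (n + 1)) from ⟨h1, h2⟩)]
  · intro m hm
    apply indicator_of_notMem
    rintro ⟨h3, h4⟩
    rcases lt_or_gt_of_ne hm with h | h
    · have := hτ.strictMono.monotone (show m + 1 ≤ n from h)
      linarith
    · have := hτ.strictMono.monotone (show n + 1 ≤ m from h)
      linarith

lemma sin_sq_pos_part {p : ℝ} (hp : p ≠ 0) (z : ℝ) :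
    (max 0 (Real.sin (p / 2 * π * z))) ^ 2 = bump p (z - 1 / p) := by
  have e : p / 2 * π * (z - 1 / p) = p / 2 * π * z - π / 2 := by field_simp
  rw [bump, e, Real.cos_sub_pi_div_two]

/-- The two sides differ at most at the switching times, where `kernelK` vanishes. -/
lemma kernelK_sq_ae_eq {p : ℝ} (hp : p ≠ 0) {τ : ℕ → ℝ} (hτ : HalfSeparated τ) :
    (fun x => (max 0 (kernelK p τ x)) ^ 2) =ᵐ[volume.restrict (Ioi 0)]
      fun x => (π ^ 2)⁻¹ * (density p τ x / x ^ 2) := by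
  have hnull : ∀ᵐ x ∂(volume.restrict (Ioi (0 : ℝ))), x ∉ range τ :=
    ae_restrict_of_ae ((countable_range τ).ae_notMem volume)
  filter_upwards [hnull, ae_restrict_mem measurableSet_Ioi] with x hx hx0
  have hx0' : 0 < x := hx0
  have h1 := hτ.switchCount_le hx0'.le
  have h2 : τ (switchCount τ x) < x := lt_of_le_of_ne h1 fun h => hx ⟨_, h⟩
  have hpos : 0 < π * x := by positivity
  rw [kernelK_eq hτ h2 (hτ.lt_switchCount x), density, ← sin_sq_pos_part hp]
  set y := Real.sin (p / 2 * π * (x - switchCount τ x))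
  have : max 0 (y / (π * x)) = max 0 y / (π * x) := by
    rw [← max_div_div_right hpos.le, zero_div]
  rw [this]
  field_simp

lemma integrableOn_inv_sq {a s : ℝ} (h : 0 < a + s) :
    IntegrableOn (fun x : ℝ => ((x + s) ^ 2)⁻¹) (Ioi a) := by
  have h1 := integrableOn_add_rpow_Ioi_of_lt (a := -2) (c := a) (m := s) (by norm_num)
    (by linarith)
  refine h1.congr_fun (fun x hx => ?_) measurableSet_Ioi
  have : 0 < x + s := by linarith [mem_Ioi.1 hx]
  simp only
  rw [Real.rpow_neg this.le, Real.rpow_two]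

namespace HalfSeparated

lemma integrableOn_density_div {τ : ℕ → ℝ} (hτ : HalfSeparated τ) (p : ℝ) {a s : ℝ}
    (h : 0 < a + s) : IntegrableOn (fun x => density p τ x / (x + s) ^ 2) (Ioi a) := by
  refine (integrableOn_inv_sq h).mono'
    ((hτ.measurable_density p).div (by fun_prop)).aestronglyMeasurable
    (Filter.Eventually.of_forall fun x => ?_)
  have h1 := density_le_one p τ x
  have h0 := density_nonneg p τ x
  rw [Real.norm_of_nonneg (by positivity), div_eq_mul_inv]
  exact mul_le_of_le_one_left (by positivity) h1

lemma integrableOn_density_div_sq {τ : ℕ → ℝ} (hτ : HalfSeparated τ) {p : ℝ} (hp : p ≠ 0) :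
    IntegrableOn (fun x => density p τ x / x ^ 2) (Ioi 0) := by
  have hu : Ioi (0 : ℝ) = Ioo 0 (1 / 2) ∪ Ici (1 / 2) := by
    rw [Ioo_union_Ici_eq_Ioi (by norm_num)]
  rw [hu]
  refine IntegrableOn.union ?_ ?_
  · refine Measure.integrableOn_of_bounded (M := (p / 2 * π) ^ 2) (by simp)
      ((hτ.measurable_density p).div (by fun_prop)).aestronglyMeasurable ?_
    filter_upwards [ae_restrict_mem measurableSet_Ioo] with x hx
    have h1 : x < τ 1 := by
      have := hτ.2 0
      rw [hτ.1] at this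
      linarith [hx.2]
    have hx0 : 0 < x := hx.1
    rw [Real.norm_of_nonneg (div_nonneg (density_nonneg _ _ _) (by positivity)), density,
      switchCount_of_lt h1, ← sin_sq_pos_part hp, div_le_iff₀ (by positivity), ← mul_pow]
    simp only [Nat.cast_zero, sub_zero]
    rw [sq_le_sq]
    refine le_trans ?_ (Real.abs_sin_le_abs (x := p / 2 * π * x))
    rcases le_total 0 (Real.sin (p / 2 * π * x)) with h | h
    · rw [max_eq_right h]
    · rw [max_eq_left h]; simp
  · rw [integrableOn_Ici_iff_integrableOn_Ioi]
    simpa using hτ.integrableOn_density_div p (a := 1 / 2) (s := 0) (by norm_num)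

lemma integrableOn_kernelK_sq {τ : ℕ → ℝ} (hτ : HalfSeparated τ) {p : ℝ} (hp : p ≠ 0) :
    IntegrableOn (fun x => (max 0 (kernelK p τ x)) ^ 2) (Ioi 0) :=
  ((hτ.integrableOn_density_div_sq hp).const_mul _).congr (kernelK_sq_ae_eq hp hτ).symm

lemma energyE_eq {τ : ℕ → ℝ} (hτ : HalfSeparated τ) {p : ℝ} (hp : p ≠ 0) :
    energyE p τ = (π ^ 2)⁻¹ * ∫ x in Ioi (0 : ℝ), density p τ x / x ^ 2 := by
  rw [energyE, integral_congr_ae (kernelK_sq_ae_eq hp hτ), integral_const_mul]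

/-- Domination of the partial integrals gives domination of the integrals against the decreasing
weight `1 / (x + s)²`, with a remainder that is positive if the domination is strict somewhere. -/
lemma integral_density_diff_le {τ σ : ℕ → ℝ} (hτ : HalfSeparated τ) (hσ : HalfSeparated σ)
    {p a s T : ℝ} (ha : 0 ≤ a) (has : 0 < a + s) (haT : a ≤ T)
    (heq : ∫ y in (0 : ℝ)..a, density p τ y = ∫ y in (0 : ℝ)..a, density p σ y)
    (hle : ∀ t, a ≤ t →
      ∫ y in (0 : ℝ)..t, density p τ y ≤ ∫ y in (0 : ℝ)..t, density p σ y) :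
    ∫ x in a..T, ((∫ y in (0 : ℝ)..x, density p σ y) - ∫ y in (0 : ℝ)..x, density p τ y) *
        (2 / (x + s) ^ 3) ≤
      (∫ x in Ioi a, density p σ x / (x + s) ^ 2) - ∫ x in Ioi a, density p τ x / (x + s) ^ 2 := by
  have hτi := hτ.integrableOn_density_div p has
  have hσi := hσ.integrableOn_density_div p has
  rw [← integral_sub hσi hτi]
  refine ge_of_tendsto (intervalIntegral_tendsto_integral_Ioi a (hσi.sub hτi) Filter.tendsto_id) ?_
  filter_upwards [Filter.eventually_ge_atTop T] with b hb
  have hab : a ≤ b := haT.trans hb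
  set u : ℝ → ℝ := fun x => (∫ y in (0 : ℝ)..x, density p σ y) - ∫ y in (0 : ℝ)..x, density p τ y
    with hu
  have huc : Continuous u :=
    (hσ.continuous_integral_density p).sub (hτ.continuous_integral_density p)
  have hpos : ∀ x ∈ Icc a b, 0 < x + s := fun x hx => by linarith [hx.1]
  have hwc : ContinuousOn (fun x : ℝ => 2 / (x + s) ^ 3) (Icc a b) :=
    continuousOn_const.div (by fun_prop) fun x hx => (pow_pos (hpos x hx) 3).ne'
  have hvc : ContinuousOn (fun x : ℝ => ((x + s) ^ 2)⁻¹) (Icc a b) :=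
    ContinuousOn.inv₀ (by fun_prop) fun x hx => (pow_pos (hpos x hx) 2).ne'
  have hparts := intervalIntegral.integral_mul_deriv_eq_deriv_mul_of_hasDeriv_right
    (a := a) (b := b) (u := u) (v := fun x => ((x + s) ^ 2)⁻¹)
    (u' := fun x => density p σ x - density p τ x) (v' := fun x => -(2 / (x + s) ^ 3))
    huc.continuousOn (by rwa [uIcc_of_le hab])
    (fun x hx => by
      rw [min_eq_left hab] at hx
      exact (hσ.hasDerivWithinAt_integral_density p (ha.trans hx.1.le)).sub
        (hτ.hasDerivWithinAt_integral_density p (ha.trans hx.1.le)))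
    (fun x hx => by
      rw [min_eq_left hab, max_eq_right hab] at hx
      have h0 := hpos x (Ioo_subset_Icc_self hx)
      have h1 : HasDerivAt (fun x : ℝ => (x + s) ^ 2) (2 * (x + s)) x := by
        simpa using ((hasDerivAt_id x).add_const s).fun_pow 2
      refine ((h1.inv (by positivity)).congr_deriv ?_).hasDerivWithinAt
      field_simp)
    ((hσ.intervalIntegrable_density p a b).sub (hτ.intervalIntegrable_density p a b))
    (ContinuousOn.intervalIntegrable (by rw [uIcc_of_le hab]; exact hwc.neg))
  have hua : u a = 0 := by simp only [hu]; rw [heq, sub_self]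
  have hu0 : ∀ x, a ≤ x → 0 ≤ u x := fun x hx => sub_nonneg.2 (hle x hx)
  have hint : ∀ c d, a ≤ c → c ≤ d → d ≤ b →
      IntervalIntegrable (fun x => u x * (2 / (x + s) ^ 3)) volume c d := fun c d h1 h2 h3 => by
    apply ContinuousOn.intervalIntegrable
    rw [uIcc_of_le h2]
    exact huc.continuousOn.mul (hwc.mono (Icc_subset_Icc h1 h3))
  have hsplit := intervalIntegral.integral_add_adjacent_intervals
    (hint a T le_rfl haT hb) (hint T b haT hb le_rfl)
  have htail : 0 ≤ ∫ x in T..b, u x * (2 / (x + s) ^ 3) :=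
    intervalIntegral.integral_nonneg hb fun x hx =>
      mul_nonneg (hu0 x (haT.trans hx.1))
        (div_nonneg zero_le_two (pow_pos (hpos x ⟨haT.trans hx.1, hx.2⟩) 3).le)
  have hboundary : 0 ≤ u b * ((b + s) ^ 2)⁻¹ := mul_nonneg (hu0 b hab) (by positivity)
  simp only [mul_neg, intervalIntegral.integral_neg] at hparts
  rw [hua, zero_mul] at hparts
  have hgoal : ∫ x in a..id b, (density p σ x / (x + s) ^ 2 - density p τ x / (x + s) ^ 2) =
      ∫ x in a..b, (density p σ x - density p τ x) * ((x + s) ^ 2)⁻¹ := by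
    refine intervalIntegral.integral_congr fun x _ => ?_
    simp only [div_eq_mul_inv, sub_mul]
  simp only [id] at hgoal ⊢
  rw [hgoal]
  linarith

lemma integral_Ioi_split {τ : ℕ → ℝ} (hτ : HalfSeparated τ) {p : ℝ} (hp : p ≠ 0) {a : ℝ}
    (ha : 0 < a) :
    ∫ x in Ioi (0 : ℝ), density p τ x / x ^ 2 =
      (∫ x in (0 : ℝ)..a, density p τ x / x ^ 2) + ∫ x in Ioi a, density p τ x / x ^ 2 := by
  have h := hτ.integrableOn_density_div_sq hp
  rw [intervalIntegral.integral_of_le ha.le, ← setIntegral_union (Ioc_disjoint_Ioi le_rfl)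
    measurableSet_Ioi (h.mono_set Ioc_subset_Ioi_self) (h.mono_set (Ioi_subset_Ioi ha.le)),
    Ioc_union_Ioi_eq_Ioi ha.le]

end HalfSeparated

section
variable {p : ℝ}

lemma integral_congr_first {τ σ : ℕ → ℝ} {a : ℝ} (g : ℝ → ℝ) (ha : 0 ≤ a)
    (h1 : a ≤ τ 1) (h2 : a ≤ σ 1) :
    ∫ x in (0 : ℝ)..a, density p τ x / g x = ∫ x in (0 : ℝ)..a, density p σ x / g x := by
  apply intervalIntegral.integral_congr_Ioo_of_le ha
  intro x hx
  simp only [density, switchCount_of_lt (hx.2.trans_le h1), switchCount_of_lt (hx.2.trans_le h2)]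

lemma integral_density_congr_first {τ σ : ℕ → ℝ} {a : ℝ} (ha : 0 ≤ a)
    (h1 : a ≤ τ 1) (h2 : a ≤ σ 1) :
    ∫ x in (0 : ℝ)..a, density p τ x = ∫ x in (0 : ℝ)..a, density p σ x := by
  simpa using integral_congr_first (p := p) (fun _ => 1) ha h1 h2

lemma optSeq_one (p : ℝ) : optSeq p 1 = 1 / 2 + 3 / p := by
  have := optSeq_succ p 0
  simpa using this

lemma integral_lt_optSeq_of_late {τ : ℕ → ℝ} (hp : 4 < p) (hp' : p ≤ 5)
    (hτ : τ ∈ sepSeq (1 / 2) (1 - 2 / p)) (h1 : 1 / 2 + 1 / p ≤ τ 1) (hne : τ ≠ optSeq p) :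
    ∫ x in Ioi (0 : ℝ), density p τ x / x ^ 2 <
      ∫ x in Ioi (0 : ℝ), density p (optSeq p) x / x ^ 2 := by
  have hp0 : p ≠ 0 := by linarith
  have hs := halfSeparated_of_mem hp hτ
  have ho := optSeq_halfSeparated hp
  have hle : ∀ t : ℝ, 1 / 2 ≤ t → ∫ y in (0 : ℝ)..t, density p τ y ≤
      ∫ y in (0 : ℝ)..t, density p (optSeq p) y :=
    fun t ht => integral_density_le hp hp' hτ h1 (by linarith)
  have ho1 : 1 / 2 ≤ optSeq p 1 := by
    rw [optSeq_one]
    have : 0 < 3 / p := by positivity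
    linarith
  obtain ⟨t, ht, hlt⟩ := exists_integral_density_lt hp hp' hτ h1 hne
  rw [hs.integral_Ioi_split hp0 one_half_pos, ho.integral_Ioi_split hp0 one_half_pos,
    integral_congr_first (p := p) _ (by norm_num) hτ.2.1 ho1]
  have hd := hs.integral_density_diff_le ho (p := p) (a := 1 / 2) (s := 0) (T := t + 1)
    (by norm_num) (by norm_num) (by linarith)
    (integral_density_congr_first (by norm_num) hτ.2.1 ho1) hle
  simp only [add_zero] at hd
  have hpos : 0 < ∫ x in (1 / 2 : ℝ)..(t + 1), ((∫ y in (0 : ℝ)..x, density p (optSeq p) y) -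
      ∫ y in (0 : ℝ)..x, density p τ y) * (2 / x ^ 3) := by
    apply intervalIntegral.integral_pos (by linarith)
    · refine ContinuousOn.mul ((ho.continuous_integral_density p).sub
        (hs.continuous_integral_density p)).continuousOn
        (continuousOn_const.div (by fun_prop) fun x hx => ?_)
      have : 0 < x := by linarith [hx.1]
      positivity
    · intro x hx
      have : 0 < x := by linarith [hx.1]
      exact mul_nonneg (sub_nonneg.2 (hle x hx.1.le)) (by positivity)
    · refine ⟨t, ⟨ht, by linarith⟩, mul_pos (sub_pos.2 hlt) ?_⟩
      have : 0 < t := by linarith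
      positivity
  linarith

end

/-! ### Removing an early first switch -/

section
variable {p : ℝ}

/-- The sequence obtained by omitting the first switch and shifting all later ones to the left
by `1 - 4 / p`, which leaves their phases unchanged. -/
noncomputable def dropFirst (p : ℝ) (τ : ℕ → ℝ) (n : ℕ) : ℝ :=
  if n = 0 then 0 else τ (n + 1) - (1 - 4 / p)

lemma dropFirst_succ (p : ℝ) (τ : ℕ → ℝ) (n : ℕ) :
    dropFirst p τ (n + 1) = τ (n + 2) - (1 - 4 / p) := by
  simp [dropFirst]

lemma dropFirst_late {τ : ℕ → ℝ}
    (hτ : τ ∈ sepSeq (1 / 2) (1 - 2 / p)) : 1 / 2 + 2 / p ≤ dropFirst p τ 1 := by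
  have h1 := hτ.2.1
  have h2 := hτ.2.2 1 le_rfl
  have e4 : 4 / p = 2 * (2 / p) := by ring
  have := dropFirst_succ p τ 0
  simp only [zero_add, Nat.reduceAdd] at this h2
  linarith

lemma dropFirst_mem (hp : 4 < p) {τ : ℕ → ℝ} (hτ : τ ∈ sepSeq (1 / 2) (1 - 2 / p)) :
    dropFirst p τ ∈ sepSeq (1 / 2) (1 - 2 / p) := by
  refine ⟨by simp [dropFirst], ?_, fun n hn => ?_⟩
  · have := dropFirst_late hτ
    have : 0 < 2 / p := by positivity
    linarith
  · obtain ⟨k, rfl⟩ := Nat.exists_eq_add_of_le' hn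
    have := hτ.2.2 (k + 2) (by omega)
    rw [dropFirst_succ, dropFirst_succ]
    linarith

/-- After the first switch the density is that of `dropFirst p τ`, delayed by `1 - 4 / p`. -/
lemma density_dropFirst (hp : 4 < p) {τ : ℕ → ℝ} (hτ : τ ∈ sepSeq (1 / 2) (1 - 2 / p)) {x : ℝ}
    (hx : τ 1 ≤ x) : density p τ x = density p (dropFirst p τ) (x - (1 - 4 / p)) := by
  have hp0 : p ≠ 0 := by linarith
  have hs := halfSeparated_of_mem hp hτ
  have hd := halfSeparated_of_mem hp (dropFirst_mem hp hτ)
  have hx0 : 0 ≤ x := by linarith [hτ.2.1]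
  have hcount : switchCount τ x = switchCount (dropFirst p τ) (x - (1 - 4 / p)) + 1 := by
    have hlt := hs.lt_switchCount x
    have hle := hs.switchCount_le hx0
    obtain ⟨n, hn⟩ : ∃ n, switchCount τ x = n + 1 := by
      refine Nat.exists_eq_succ_of_ne_zero fun h => ?_
      rw [h, zero_add] at hlt
      linarith
    rw [hn] at hlt hle ⊢
    have hlt' : x - (1 - 4 / p) < dropFirst p τ (n + 1) := by
      rw [dropFirst_succ]
      linarith
    rcases n with _ | n
    · rw [switchCount_of_lt hlt']
    · rw [hd.switchCount_eq (n := n + 1) (by rw [dropFirst_succ]; linarith) hlt']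
  rw [density, density, hcount, ← bump_add_period hp0]
  congr 1
  push_cast
  ring

lemma HalfSeparated.integral_Ioi_add {τ : ℕ → ℝ} (hτ : HalfSeparated τ) {a b s : ℝ}
    (has : 0 < a + s) (hab : a ≤ b) :
    ∫ x in Ioi a, density p τ x / (x + s) ^ 2 =
      (∫ x in a..b, density p τ x / (x + s) ^ 2) + ∫ x in Ioi b, density p τ x / (x + s) ^ 2 := by
  have h := hτ.integrableOn_density_div p has
  rw [intervalIntegral.integral_of_le hab, ← setIntegral_union (Ioc_disjoint_Ioi le_rfl)
    measurableSet_Ioi (h.mono_set Ioc_subset_Ioi_self) (h.mono_set (Ioi_subset_Ioi hab)),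
    Ioc_union_Ioi_eq_Ioi hab]

lemma inv_sq_sub_inv_sq_ge {m e : ℝ} (he : 0 ≤ e) (hem : e < m) :
    4 * e / m ^ 3 ≤ ((m - e) ^ 2)⁻¹ - ((m + e) ^ 2)⁻¹ := by
  have hm : 0 < m := by linarith
  have h1 : 0 < m - e := by linarith
  have h2 : 0 < m + e := by linarith
  have h3 : ((m - e) ^ 2)⁻¹ - ((m + e) ^ 2)⁻¹ = 4 * e * m / ((m - e) * (m + e)) ^ 2 := by
    field_simp
    ring
  have h4 : 4 * e / m ^ 3 = 4 * e * m / (m * m) ^ 2 := by field_simp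
  rw [h3, h4]
  have : (m - e) * (m + e) ≤ m * m := by nlinarith
  have h5 : 0 < (m - e) * (m + e) := by positivity
  gcongr

lemma two_div_cube_le {m y : ℝ} (hy : 0 ≤ y) (hym : y < m) :
    2 / m ^ 3 ≤ 1 / (m - y) ^ 3 + 1 / (m + y) ^ 3 := by
  have hm : 0 < m := by linarith
  have h1 : 0 < m - y := by linarith
  have h2 : 0 < m + y := by linarith
  have h3 : 1 / (m - y) ^ 3 + 1 / (m + y) ^ 3 =
      (2 * m ^ 3 + 6 * m * y ^ 2) / ((m - y) * (m + y)) ^ 3 := by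
    field_simp
    ring
  have h4 : 2 / m ^ 3 = (2 * m ^ 3) / (m * m) ^ 3 := by field_simp
  rw [h3, h4]
  have : (m - y) * (m + y) ≤ m * m := by nlinarith
  have h5 : 0 < (m - y) * (m + y) := by positivity
  have h6 : 0 ≤ 6 * m * y ^ 2 := by positivity
  gcongr
  linarith

/-- The loss caused by a delay `2 e`, averaged over two points symmetric about `c`. -/
lemma delay_loss_pair_ge {c e y : ℝ} (he : 0 ≤ e) (hy : 0 ≤ y) (hyc : y < c) :
    8 * e / (c + e) ^ 3 ≤
      ((c - y) ^ 2)⁻¹ - ((c - y + 2 * e) ^ 2)⁻¹ + (((c + y) ^ 2)⁻¹ - ((c + y + 2 * e) ^ 2)⁻¹) := by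
  have h1 := inv_sq_sub_inv_sq_ge he (m := c - y + e) (by linarith)
  have h2 := inv_sq_sub_inv_sq_ge he (m := c + y + e) (by linarith)
  have h3 := two_div_cube_le hy (m := c + e) (by linarith)
  have e1 : c - y + e - e = c - y := by ring
  have e2 : c - y + e + e = c - y + 2 * e := by ring
  have e3 : c + y + e - e = c + y := by ring
  have e4 : c + y + e + e = c + y + 2 * e := by ring
  have e5 : c + e - y = c - y + e := by ring
  have e6 : c + e + y = c + y + e := by ring
  rw [e1, e2] at h1
  rw [e3, e4] at h2
  rw [e5, e6] at h3
  have h4 := mul_le_mul_of_nonneg_left h3 (by linarith : 0 ≤ 4 * e)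
  have e7 : 4 * e * (2 / (c + e) ^ 3) = 8 * e / (c + e) ^ 3 := by ring
  have e8 : 4 * e * (1 / (c - y + e) ^ 3 + 1 / (c + y + e) ^ 3) =
    4 * e / (c - y + e) ^ 3 + 4 * e / (c + y + e) ^ 3 := by ring
  linarith

/-- The numerical inequality between the largest gain of an early first switch (left) and the
smallest loss caused by the delay on the first bump beyond `4 / p` (right). -/
lemma early_gain_lt_loss (hp : 4 < p) (hp' : p ≤ 5) :
    4 * windowMass p (1 / p) <
      8 * ((1 - 4 / p) / 2) / (1 + 1 / p) ^ 3 * (windowMass p 0 / 2 + 1 / p / 2) := by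
  obtain ⟨h5, h4⟩ := one_div_bounds hp hp'
  have hgain : 2 * windowMass p (1 / p) = (1 - 4 / p) / 2 -
      Real.sin (p / 2 * π * (1 - 4 / p)) / (2 * (p / 2 * π)) := by
    have h := windowMass_pair hp (1 / p)
    have e1 : 2 * (p / 2 * π * (1 / p)) = π := by field_simp
    have e2 : windowMass p (1 / p + 2 / p) = windowMass p (1 / p) := by
      rw [← windowMass_neg p (1 / p), ← windowMass_add_period (by linarith) (-(1 / p))]
      congr 1
      ring
    rw [e1, e2, Real.cos_pi, mul_neg_one, neg_div] at h
    linarith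
  have hm : 0 < p / 2 * π := by positivity
  have hε : 0 < 1 - 4 / p := by
    have : 4 / p = 4 * (1 / p) := by ring
    linarith
  have hy0 : 0 ≤ p / 2 * π * (1 - 4 / p) := by positivity
  have key : ∀ q : ℝ, q * (p / 2 * π * (1 - 4 / p)) ≤ Real.sin (p / 2 * π * (1 - 4 / p)) →
      q * (1 - 4 / p) ≤ Real.sin (p / 2 * π * (1 - 4 / p)) / (p / 2 * π) := fun q hq => by
    rw [le_div_iff₀ hm]
    linarith
  -- It suffices to have a lower bound `q` for `sin y / y`, where `y = p π (1 - 4 / p) / 2`.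
  have hfin : ∀ q : ℝ,
      q * (p / 2 * π * (1 - 4 / p)) ≤ Real.sin (p / 2 * π * (1 - 4 / p)) →
      (1 - q) * (1 + 1 / p) ^ 3 < 2 * (1 / p) + (1 - 4 * (1 / p)) * (1 + q) →
      4 * windowMass p (1 / p) <
      8 * ((1 - 4 / p) / 2) / (1 + 1 / p) ^ 3 * (windowMass p 0 / 2 + 1 / p / 2) := by
    intro q hq hnum
    have hX := key q hq
    rw [windowMass_zero hp hp']
    have e1 : Real.sin (p / 2 * π * (1 - 4 / p)) / (2 * (p / 2 * π)) =
        Real.sin (p / 2 * π * (1 - 4 / p)) / (p / 2 * π) / 2 := by ring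
    rw [e1] at hgain ⊢
    set X := Real.sin (p / 2 * π * (1 - 4 / p)) / (p / 2 * π)
    have e4 : 4 / p = 4 * (1 / p) := by ring
    rw [e4] at hgain hX hε ⊢
    set t := 1 / p
    have ht3 : 0 < (1 + t) ^ 3 := by positivity
    rw [div_mul_eq_mul_div, lt_div_iff₀ ht3]
    have h8 : 4 * windowMass p t ≤ (1 - q) * (1 - 4 * t) := by linarith
    have h9 := mul_le_mul_of_nonneg_right h8 ht3.le
    have h10 := mul_lt_mul_of_pos_left hnum hε
    have h11 := mul_le_mul_of_nonneg_left hX hε.le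
    nlinarith
  have hlin := Real.mul_le_sin hy0 (by
    have : p / 2 * π * (1 - 4 / p) = π * ((p - 4) / 2) := by field_simp
    rw [this]
    nlinarith [Real.pi_pos])
  rcases le_or_gt (1 / p) (21 / 100) with hc | hc
  -- `sin y / y ≥ 2 / π` on `[0, π / 2]`, and `2 / π ≥ 0.63`.
  · refine hfin (63 / 100) (le_trans ?_ hlin) ?_
    · refine mul_le_mul_of_nonneg_right ?_ hy0
      rw [le_div_iff₀ Real.pi_pos]
      linarith [Real.pi_lt_d2]
    · nlinarith [pow_le_pow_left₀ (by linarith) (by linarith : 1 + 1 / p ≤ 121 / 100) 3]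
  -- `sin y ≥ y - y³ / 6` with `y ≤ 1.2`, so that `sin y / y ≥ 0.76`.
  · refine hfin (76 / 100) (le_trans ?_ (Real.sin_ge_sub_cube hy0)) ?_
    · have hyb : p / 2 * π * (1 - 4 / p) ≤ 12 / 10 := by
        have e : p / 2 * π * (1 - 4 / p) = π * ((p - 4) / 2) := by field_simp
        have hpb : p < 100 / 21 := by
          rw [lt_div_iff₀ (by linarith)] at hc
          linarith
        rw [e]
        nlinarith [Real.pi_lt_d2, Real.pi_pos]
      nlinarith [mul_le_mul hyb hyb hy0 (by norm_num)]
    · nlinarith [pow_le_pow_left₀ (by linarith) (by linarith : 1 + 1 / p ≤ 125 / 100) 3]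

end

/-! ### Comparison of energies when the first switch is early -/

section
variable {p : ℝ}

lemma density_optSeq_first {x : ℝ} (hx : x < 1 / 2 + 3 / p) :
    density p (optSeq p) x = bump p (x - 1 / p) := by
  rw [density, switchCount_of_lt (by rwa [optSeq_one])]
  simp

lemma density_optSeq_second (hp : 4 < p) {x : ℝ} (hx : 1 / 2 + 3 / p ≤ x)
    (hx' : x < 3 / 2 + 3 / p) : density p (optSeq p) x = bump p (x - 1 - 1 / p) := by
  have h2 := optSeq_succ p 1
  push_cast at h2
  rw [(optSeq_halfSeparated hp).density_eq (n := 1) (by rwa [optSeq_one])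
    (by rw [h2]; linarith)]
  simp

/-- The gain of a first switch at `u ≤ 1/2 + 1/p`: the extremal density on the window before `u`
is collected once more, at points `x + (1 - 4 / p) ≥ 1/2`. -/
lemma delayed_gain_le (hp : 4 < p) (hp' : p ≤ 5) {u : ℝ} (hu : 1 / 2 ≤ u)
    (hu' : u ≤ 1 / 2 + 1 / p) :
    ∫ x in (u - (1 - 4 / p))..u, density p (optSeq p) x / (x + (1 - 4 / p)) ^ 2 ≤
      4 * windowMass p (1 / p) := by
  obtain ⟨h5, h4⟩ := one_div_bounds hp hp'
  have e4 : 4 / p = 4 * (1 / p) := by ring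
  have e3 : 3 / p = 3 * (1 / p) := by ring
  have hε : 0 < 1 - 4 / p := by linarith
  have hcont : Continuous fun x => bump p (x - 1 / p) * 4 :=
    ((continuous_bump p).comp (continuous_sub_right _)).mul continuous_const
  have h1 : ∫ x in (u - (1 - 4 / p))..u, density p (optSeq p) x / (x + (1 - 4 / p)) ^ 2 ≤
      ∫ x in (u - (1 - 4 / p))..u, bump p (x - 1 / p) * 4 := by
    refine intervalIntegral.integral_mono_on (by linarith) ?_ (hcont.intervalIntegrable _ _) ?_
    · have h := ((optSeq_halfSeparated hp).intervalIntegrable_density p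
        (u - (1 - 4 / p)) u).mul_continuousOn (g := fun x => ((x + (1 - 4 / p)) ^ 2)⁻¹) ?_
      · simpa only [div_eq_mul_inv] using h
      · rw [uIcc_of_le (by linarith)]
        refine ContinuousOn.inv₀ (by fun_prop) fun x hx => ?_
        have : 0 < x + (1 - 4 / p) := by linarith [hx.1]
        positivity
    · intro x hx
      rw [density_optSeq_first (by linarith [hx.2]), div_eq_mul_inv]
      refine mul_le_mul_of_nonneg_left ?_ (bump_nonneg _ _)
      have hx1 : 1 / 2 ≤ x + (1 - 4 / p) := by linarith [hx.1]
      rw [inv_le_comm₀ (by positivity) (by norm_num)]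
      nlinarith
  refine h1.trans ?_
  rw [intervalIntegral.integral_mul_const, intervalIntegral.integral_comp_sub_right
    (fun x => bump p x), ← bumpInt_sub, windowMass]
  -- `bump` vanishes between the two points, which both lie in `[1/p, 3/p]`.
  have hflat : bumpInt p (u - 1 / p) = bumpInt p (1 / p + (1 - 4 / p) / 2) := by
    rw [← sub_eq_zero, bumpInt_sub, intervalIntegral.integral_congr (g := fun _ => 0)]
    · simp
    · intro z hz
      rw [uIcc_of_le (by linarith)] at hz
      exact bump_eq_zero (by linarith) (by linarith [hz.1]) (by linarith [hz.2])
  have hlow : bumpInt p (1 / p - (1 - 4 / p) / 2) ≤ bumpInt p (u - (1 - 4 / p) - 1 / p) :=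
    bumpInt_mono p (by linarith)
  linarith

lemma half_bump_mass (hp : 4 < p) (hp' : p ≤ 5) :
    ∫ y in (0 : ℝ)..(1 / 2 - 1 / p), bump p (1 / 2 + 2 / p - y) =
      windowMass p 0 / 2 + 1 / p / 2 := by
  obtain ⟨h5, h4⟩ := one_div_bounds hp hp'
  have hp0 : p ≠ 0 := by linarith
  have hm : p / 2 * π ≠ 0 := by positivity
  rw [intervalIntegral.integral_comp_sub_left (fun x => bump p x), ← bumpInt_sub]
  have e1 : 1 / 2 + 2 / p - 0 = (1 - 4 / p) / 2 + 4 / p := by ring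
  have e2 : 1 / 2 + 2 / p - (1 / 2 - 1 / p) = -(1 / p) + 4 / p := by ring
  have hquarter : bumpInt p (1 / p) = 1 / p / 2 := by
    rw [bumpInt, intervalIntegral.integral_congr
      (g := fun z => Real.cos (p / 2 * π * z) ^ 2), integral_cos_mul_sq hm]
    · have e3 : 2 * (p / 2 * π * (1 / p)) = π := by field_simp
      rw [e3]
      simp
    · intro z hz
      rw [uIcc_of_le (by linarith)] at hz
      exact bump_eq_cos_sq (by linarith) (by linarith [hz.1]) hz.2
  rw [e1, e2, bumpInt_sub_shift hp0, windowMass, zero_add, zero_sub, bumpInt_neg, bumpInt_neg,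
    hquarter]
  ring

/-- The loss from delaying the first bump of the extremal density beyond `4 / p`. -/
lemma delay_loss_ge (hp : 4 < p) (hp' : p ≤ 5) {u : ℝ} (hu : 1 / 2 ≤ u)
    (hu' : u ≤ 1 / 2 + 1 / p) :
    8 * ((1 - 4 / p) / 2) / (1 + 1 / p) ^ 3 * (windowMass p 0 / 2 + 1 / p / 2) ≤
      (∫ x in u..(1 + 2 / p), density p (optSeq p) x / x ^ 2) -
        ∫ x in u..(1 + 2 / p), density p (optSeq p) x / (x + (1 - 4 / p)) ^ 2 := by
  obtain ⟨h5, h4⟩ := one_div_bounds hp hp'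
  have hp0 : p ≠ 0 := by linarith
  have e4 : 4 / p = 4 * (1 / p) := by ring
  have e3 : 3 / p = 3 * (1 / p) := by ring
  have e2 : 2 / p = 2 * (1 / p) := by ring
  have hε : 0 < 1 - 4 / p := by linarith
  have ho := optSeq_halfSeparated hp
  have hint : ∀ s c d : ℝ, 0 ≤ s → 0 < c → c ≤ d →
      IntervalIntegrable (fun x => density p (optSeq p) x / (x + s) ^ 2) volume c d := by
    intro s c d hs hc hcd
    have h := (ho.intervalIntegrable_density p c d).mul_continuousOn
      (g := fun x => ((x + s) ^ 2)⁻¹) ?_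
    · simpa only [div_eq_mul_inv] using h
    · rw [uIcc_of_le hcd]
      refine ContinuousOn.inv₀ (by fun_prop) fun x hx => ?_
      have : 0 < x + s := by linarith [hx.1]
      positivity
  have hint0 : ∀ c d : ℝ, 0 < c → c ≤ d →
      IntervalIntegrable (fun x => density p (optSeq p) x / x ^ 2) volume c d := by
    intro c d hc hcd
    simpa using hint 0 c d le_rfl hc hcd
  set F : ℝ → ℝ := fun x => density p (optSeq p) x / x ^ 2 -
    density p (optSeq p) x / (x + (1 - 4 / p)) ^ 2 with hF
  have hFint : ∀ c d : ℝ, 0 < c → c ≤ d → IntervalIntegrable F volume c d :=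
    fun c d hc hcd => (hint0 c d hc hcd).sub (hint _ c d hε.le hc hcd)
  have hF0 : ∀ x : ℝ, 0 < x → 0 ≤ F x := by
    intro x hx
    have h0 := density_nonneg p (optSeq p) x
    rw [hF, sub_nonneg]
    gcongr
    linarith
  rw [← intervalIntegral.integral_sub (hint0 _ _ (by linarith) (by linarith))
    (hint _ _ _ hε.le (by linarith) (by linarith))]
  change _ ≤ ∫ x in u..(1 + 2 / p), F x
  have hs1 := intervalIntegral.integral_add_adjacent_intervals
    (hFint u (4 / p) (by linarith) (by linarith))
    (hFint (4 / p) (1 + 2 / p) (by linarith) (by linarith))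
  have hs2 := intervalIntegral.integral_add_adjacent_intervals
    (hFint (4 / p) (1 / 2 + 3 / p) (by linarith) (by linarith))
    (hFint (1 / 2 + 3 / p) (1 + 2 / p) (by linarith) (by linarith))
  have hnn : 0 ≤ ∫ x in u..(4 / p), F x :=
    intervalIntegral.integral_nonneg (by linarith) fun x hx => hF0 x (by linarith [hx.1])
  -- Fold the interval `[4/p, 1 + 2/p]` at its midpoint, about which the density is symmetric.
  have hl : ∫ x in (4 / p)..(1 / 2 + 3 / p), F x =
      ∫ y in (0 : ℝ)..(1 / 2 - 1 / p), F (1 / 2 + 3 / p - y) := by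
    rw [intervalIntegral.integral_comp_sub_left F]
    congr 1 <;> ring
  have hr : ∫ x in (1 / 2 + 3 / p)..(1 + 2 / p), F x =
      ∫ y in (0 : ℝ)..(1 / 2 - 1 / p), F (1 / 2 + 3 / p + y) := by
    rw [intervalIntegral.integral_comp_add_left F]
    congr 1 <;> ring
  have hli : IntervalIntegrable (fun y => F (1 / 2 + 3 / p - y)) volume 0 (1 / 2 - 1 / p) := by
    have := (hFint (4 / p) (1 / 2 + 3 / p) (by linarith) (by linarith)).comp_sub_left
      (1 / 2 + 3 / p)
    convert this.symm using 1 <;> ring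
  have hri : IntervalIntegrable (fun y => F (1 / 2 + 3 / p + y)) volume 0 (1 / 2 - 1 / p) := by
    have := (hFint (1 / 2 + 3 / p) (1 + 2 / p) (by linarith) (by linarith)).comp_add_left
      (1 / 2 + 3 / p)
    convert this using 1 <;> ring
  have hmass := half_bump_mass hp hp'
  have hcont : Continuous fun y => bump p (1 / 2 + 2 / p - y) :=
    (continuous_bump p).comp (by fun_prop)
  have hmain : ∫ y in (0 : ℝ)..(1 / 2 - 1 / p),
      8 * ((1 - 4 / p) / 2) / (1 + 1 / p) ^ 3 * bump p (1 / 2 + 2 / p - y) ≤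
      ∫ y in (0 : ℝ)..(1 / 2 - 1 / p), (F (1 / 2 + 3 / p - y) + F (1 / 2 + 3 / p + y)) := by
    refine intervalIntegral.integral_mono_on_of_le_Ioo (by linarith)
      ((continuous_const.mul hcont).intervalIntegrable _ _) (hli.add hri) fun y hy => ?_
    have hb1 : density p (optSeq p) (1 / 2 + 3 / p - y) = bump p (1 / 2 + 2 / p - y) := by
      rw [density_optSeq_first (by linarith [hy.1])]
      congr 1
      ring
    have hb2 : density p (optSeq p) (1 / 2 + 3 / p + y) = bump p (1 / 2 + 2 / p - y) := by
      rw [density_optSeq_second hp (by linarith [hy.1]) (by linarith [hy.2]), ← bump_neg,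
        ← bump_add_period hp0]
      congr 1
      ring
    have hpair := delay_loss_pair_ge (c := 1 / 2 + 3 / p) (e := (1 - 4 / p) / 2) (y := y)
      (by linarith) hy.1.le (by linarith [hy.2])
    have e5 : 1 / 2 + 3 / p + (1 - 4 / p) / 2 = 1 + 1 / p := by ring
    have e6 : 2 * ((1 - 4 / p) / 2) = 1 - 4 / p := by ring
    rw [e5, e6] at hpair
    simp only [hF, hb1, hb2, div_eq_mul_inv (bump _ _)]
    have := mul_le_mul_of_nonneg_right hpair (bump_nonneg p (1 / 2 + 2 / p - y))
    linarith
  rw [intervalIntegral.integral_const_mul, hmass, intervalIntegral.integral_add hli hri,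
    ← hl, ← hr] at hmain
  linarith

lemma integral_Ioi_shift (g : ℝ → ℝ) (a s : ℝ) :
    ∫ x in Ioi a, g x = ∫ x in Ioi (a - s), g (x + s) := by
  have h := (measurePreserving_add_right volume s).setIntegral_preimage_emb
    (measurableEmbedding_addRight s) g (Ioi a)
  rw [← h]
  congr 2
  ext x
  simp [sub_lt_iff_lt_add]

lemma integral_lt_optSeq_of_early {τ : ℕ → ℝ} (hp : 4 < p) (hp' : p ≤ 5)
    (hτ : τ ∈ sepSeq (1 / 2) (1 - 2 / p)) (h1 : τ 1 ≤ 1 / 2 + 1 / p) :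
    ∫ x in Ioi (0 : ℝ), density p τ x / x ^ 2 <
      ∫ x in Ioi (0 : ℝ), density p (optSeq p) x / x ^ 2 := by
  obtain ⟨h5, h4⟩ := one_div_bounds hp hp'
  have hp0 : p ≠ 0 := by linarith
  have e4 : 4 / p = 4 * (1 / p) := by ring
  have e3 : 3 / p = 3 * (1 / p) := by ring
  have e2 : 2 / p = 2 * (1 / p) := by ring
  have hε : 0 < 1 - 4 / p := by linarith
  have hτ1 := hτ.2.1
  have hs := halfSeparated_of_mem hp hτ
  have ho := optSeq_halfSeparated hp
  have hdm := dropFirst_mem hp hτ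
  have hd := halfSeparated_of_mem hp hdm
  have hlate := dropFirst_late hτ
  have ho1 : τ 1 ≤ optSeq p 1 := by rw [optSeq_one]; linarith
  rw [hs.integral_Ioi_split hp0 (by linarith : 0 < τ 1),
    ho.integral_Ioi_split hp0 (by linarith : 0 < τ 1),
    integral_congr_first (p := p) _ (by linarith) le_rfl ho1]
  have htail : ∫ x in Ioi (τ 1), density p τ x / x ^ 2 =
      ∫ x in Ioi (τ 1 - (1 - 4 / p)), density p (dropFirst p τ) x / (x + (1 - 4 / p)) ^ 2 := by
    rw [integral_Ioi_shift _ _ (1 - 4 / p)]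
    refine setIntegral_congr_fun measurableSet_Ioi fun x hx => ?_
    have hx' : τ 1 ≤ x + (1 - 4 / p) := by linarith [mem_Ioi.1 hx]
    simp only [density_dropFirst hp hτ hx', add_sub_cancel_right]
  have hcmp := hd.integral_density_diff_le ho (p := p) (a := τ 1 - (1 - 4 / p))
    (s := 1 - 4 / p) (T := τ 1 - (1 - 4 / p)) (by linarith) (by linarith) le_rfl
    (integral_density_congr_first (by linarith) (by linarith) (by linarith))
    (fun t ht => integral_density_le hp hp' hdm (by linarith) (by linarith))
  rw [intervalIntegral.integral_same, sub_nonneg] at hcmp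
  have hsp1 := ho.integral_Ioi_add (p := p) (a := τ 1 - (1 - 4 / p)) (b := τ 1)
    (s := 1 - 4 / p) (by linarith) (by linarith)
  have hsp2 := ho.integral_Ioi_add (p := p) (a := τ 1) (b := 1 + 2 / p)
    (s := 1 - 4 / p) (by linarith) (by linarith)
  have hsp3 := ho.integral_Ioi_add (p := p) (a := τ 1) (b := 1 + 2 / p)
    (s := 0) (by linarith) (by linarith)
  simp only [add_zero] at hsp3
  have hfar : ∫ x in Ioi (1 + 2 / p), density p (optSeq p) x / (x + (1 - 4 / p)) ^ 2 ≤
      ∫ x in Ioi (1 + 2 / p), density p (optSeq p) x / x ^ 2 := by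
    refine setIntegral_mono_on (ho.integrableOn_density_div p (by linarith))
      (by simpa using ho.integrableOn_density_div p (a := 1 + 2 / p) (s := 0) (by linarith))
      measurableSet_Ioi fun x hx => ?_
    have hx0 : 0 < x := by linarith [mem_Ioi.1 hx]
    have := density_nonneg p (optSeq p) x
    gcongr
    linarith
  have hgain := delayed_gain_le hp hp' hτ1 h1
  have hloss := delay_loss_ge hp hp' hτ1 h1
  have hnum := early_gain_lt_loss hp hp'
  linarith

lemma energyE_lt_optSeq {τ : ℕ → ℝ} (hp : 4 < p) (hp' : p ≤ 5)
    (hτ : τ ∈ sepSeq (1 / 2) (1 - 2 / p)) (hne : τ ≠ optSeq p) :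
    energyE p τ < energyE p (optSeq p) := by
  have hp0 : p ≠ 0 := by linarith
  rw [(halfSeparated_of_mem hp hτ).energyE_eq hp0, (optSeq_halfSeparated hp).energyE_eq hp0]
  apply mul_lt_mul_of_pos_left _ (by positivity)
  rcases le_total (τ 1) (1 / 2 + 1 / p) with h | h
  · exact integral_lt_optSeq_of_early hp hp' hτ h
  · exact integral_lt_optSeq_of_late hp hp' hτ h hne

end

/-! ### The value of the extremal energy -/

section
variable {p : ℝ}

lemma bump_eq_sin_sq {y : ℝ} (hp : 0 < p) (h1 : 0 ≤ y) (h2 : y ≤ 2 / p) :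
    bump p (y - 1 / p) = Real.sin (p / 2 * π * y) ^ 2 := by
  have hm : 0 < p / 2 * π := by positivity
  have e : p / 2 * π * (2 / p) = π := by field_simp
  have h3 := mul_le_mul_of_nonneg_left h2 hm.le
  rw [← sin_sq_pos_part hp.ne', max_eq_right
    (Real.sin_nonneg_of_nonneg_of_le_pi (by positivity) (by linarith))]

lemma bump_eq_sin_sq_next {y : ℝ} (hp : 0 < p) (h1 : 4 / p ≤ y) (h2 : y ≤ 6 / p) :
    bump p (y - 1 / p) = Real.sin (p / 2 * π * y) ^ 2 := by
  have e6 : 6 / p = 2 / p + 4 / p := by ring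
  have h := bump_eq_sin_sq hp (y := y - 4 / p) (by linarith) (by linarith)
  have e : p / 2 * π * (y - 4 / p) = p / 2 * π * y - 2 * π := by field_simp; ring
  rw [e, Real.sin_sub_two_pi] at h
  rw [← h, ← bump_add_period hp.ne' (y - 4 / p - 1 / p)]
  congr 1
  ring

lemma intervalIntegrable_optSeq (hp : 4 < p) {c d : ℝ} (hc : 0 ≤ c) (hcd : c ≤ d) :
    IntervalIntegrable (fun x => density p (optSeq p) x / x ^ 2) volume c d := by
  rw [intervalIntegrable_iff_integrableOn_Ioc_of_le hcd]
  exact ((optSeq_halfSeparated hp).integrableOn_density_div_sq (by linarith)).mono_set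
    (Ioc_subset_Ioi_self.trans (Ioi_subset_Ioi hc))

lemma integral_optSeq_head (hp : 4 < p) (hp' : p ≤ 5) :
    (π ^ 2)⁻¹ * ∫ x in (0 : ℝ)..(2 / p), density p (optSeq p) x / x ^ 2 =
      ∫ x in (0 : ℝ)..(2 / p), Real.sin (p / 2 * π * x) ^ 2 / (π ^ 2 * x ^ 2) := by
  obtain ⟨h5, h4⟩ := one_div_bounds hp hp'
  have e3 : 3 / p = 3 * (1 / p) := by ring
  have e2 : 2 / p = 2 * (1 / p) := by ring
  rw [← intervalIntegral.integral_const_mul]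
  refine intervalIntegral.integral_congr_Ioo_of_le (by linarith) fun x hx => ?_
  rw [density_optSeq_first (by linarith [hx.2]), bump_eq_sin_sq (by linarith) hx.1.le hx.2.le,
    ← div_div, inv_mul_eq_div, div_right_comm]

/-- Between `n + 2/p` and `n + 4/p` the density of the extremal sequence vanishes. -/
lemma integral_optSeq_before (hp : 4 < p) (hp' : p ≤ 5) (n : ℕ) :
    (π ^ 2)⁻¹ * ∫ x in ((n : ℝ) + 2 / p)..(optSeq p (n + 1)), density p (optSeq p) x / x ^ 2 =
      ∫ x in ((n : ℝ) + 4 / p)..((n : ℝ) + 1 / 2 + 3 / p),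
        Real.sin (p / 2 * π * (x - n)) ^ 2 / (π ^ 2 * x ^ 2) := by
  obtain ⟨h5, h4⟩ := one_div_bounds hp hp'
  have e6 : 6 / p = 6 * (1 / p) := by ring
  have e4 : 4 / p = 4 * (1 / p) := by ring
  have e3 : 3 / p = 3 * (1 / p) := by ring
  have e2 : 2 / p = 2 * (1 / p) := by ring
  have hn : (0 : ℝ) ≤ n := Nat.cast_nonneg n
  have hstart : optSeq p n ≤ n + 2 / p := by
    rcases n with _ | n
    · simp only [optSeq, if_true]
      linarith
    · rw [optSeq_succ]
      push_cast
      linarith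
  have hden : ∀ x, (n : ℝ) + 2 / p < x → x < n + 1 / 2 + 3 / p →
      density p (optSeq p) x = bump p (x - n - 1 / p) := fun x hx hx' =>
    (optSeq_halfSeparated hp).density_eq (by linarith) (by rwa [optSeq_succ])
  rw [optSeq_succ, ← intervalIntegral.integral_add_adjacent_intervals
    (intervalIntegrable_optSeq hp (by linarith) (by linarith : (n : ℝ) + 2 / p ≤ n + 4 / p))
    (intervalIntegrable_optSeq hp (by linarith) (by linarith))]
  have hzero : ∫ x in ((n : ℝ) + 2 / p)..(n + 4 / p), density p (optSeq p) x / x ^ 2 = 0 := by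
    rw [intervalIntegral.integral_congr_Ioo_of_le (g := fun _ => 0) (by linarith)]
    · simp
    · intro x hx
      simp only
      rw [hden x hx.1 (by linarith [hx.2]),
        bump_eq_zero (by linarith) (by linarith [hx.1]) (by linarith [hx.2]), zero_div]
  rw [hzero, zero_add, ← intervalIntegral.integral_const_mul]
  refine intervalIntegral.integral_congr_Ioo_of_le (by linarith) fun x hx => ?_
  rw [hden x (by linarith [hx.1]) hx.2,
    bump_eq_sin_sq_next (by linarith) (by linarith [hx.1]) (by linarith [hx.2]),
    ← div_div, inv_mul_eq_div, div_right_comm]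

lemma integral_optSeq_after (hp : 4 < p) (hp' : p ≤ 5) (n : ℕ) :
    (π ^ 2)⁻¹ * ∫ x in (optSeq p (n + 1))..((n + 1 : ℕ) + 2 / p),
        density p (optSeq p) x / x ^ 2 =
      ∫ x in ((n : ℝ) + 1 / 2 + 3 / p)..((n : ℝ) + 1 + 2 / p),
        Real.sin (p / 2 * π * (x - n - 1)) ^ 2 / (π ^ 2 * x ^ 2) := by
  obtain ⟨h5, h4⟩ := one_div_bounds hp hp'
  have e3 : 3 / p = 3 * (1 / p) := by ring
  have e2 : 2 / p = 2 * (1 / p) := by ring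
  rw [optSeq_succ, Nat.cast_succ, ← intervalIntegral.integral_const_mul]
  refine intervalIntegral.integral_congr_Ioo_of_le (by linarith) fun x hx => ?_
  have hn2 := optSeq_succ p (n + 1)
  push_cast at hn2
  rw [(optSeq_halfSeparated hp).density_eq (n := n + 1) (by rw [optSeq_succ]; exact hx.1.le)
    (by rw [hn2]; linarith [hx.2]), Nat.cast_succ, ← sub_sub x,
    bump_eq_sin_sq (by linarith) (by linarith [hx.1]) (by linarith [hx.2]),
    ← div_div, inv_mul_eq_div, div_right_comm]

lemma integral_optSeq_partial (hp : 4 < p) (hp' : p ≤ 5) (N : ℕ) :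
    (π ^ 2)⁻¹ * ∫ x in (0 : ℝ)..(optSeq p (N + 1)), density p (optSeq p) x / x ^ 2 =
      (∫ x in (0 : ℝ)..(2 / p), Real.sin (p / 2 * π * x) ^ 2 / (π ^ 2 * x ^ 2)) +
      (∑ n ∈ Finset.range (N + 1), ∫ x in ((n : ℝ) + 4 / p)..((n : ℝ) + 1 / 2 + 3 / p),
        Real.sin (p / 2 * π * (x - n)) ^ 2 / (π ^ 2 * x ^ 2)) +
      ∑ n ∈ Finset.range N, ∫ x in ((n : ℝ) + 1 / 2 + 3 / p)..((n : ℝ) + 1 + 2 / p),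
        Real.sin (p / 2 * π * (x - n - 1)) ^ 2 / (π ^ 2 * x ^ 2) := by
  obtain ⟨h5, h4⟩ := one_div_bounds hp hp'
  have e3 : 3 / p = 3 * (1 / p) := by ring
  have e2 : 2 / p = 2 * (1 / p) := by ring
  induction N with
  | zero =>
    have h := integral_optSeq_before hp hp' 0
    rw [optSeq_succ] at h ⊢
    rw [← intervalIntegral.integral_add_adjacent_intervals
      (intervalIntegrable_optSeq hp le_rfl (by linarith : 0 ≤ 2 / p))
      (intervalIntegrable_optSeq hp (by linarith) (by push_cast; linarith)), mul_add,
      integral_optSeq_head hp hp', Finset.sum_range_one, Finset.sum_range_zero, add_zero, ← h]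
    simp
  | succ N ih =>
    have hN : (0 : ℝ) ≤ N := Nat.cast_nonneg N
    have ho1 := optSeq_succ p N
    have ho2 := optSeq_succ p (N + 1)
    push_cast at ho2
    rw [← intervalIntegral.integral_add_adjacent_intervals
      (intervalIntegrable_optSeq hp le_rfl (by linarith : 0 ≤ optSeq p (N + 1)))
      (intervalIntegrable_optSeq hp (by linarith) (by linarith)),
      ← intervalIntegral.integral_add_adjacent_intervals
      (intervalIntegrable_optSeq hp (by linarith)
        (by push_cast; linarith : optSeq p (N + 1) ≤ (N + 1 : ℕ) + 2 / p))
      (intervalIntegrable_optSeq hp (by positivity) (by push_cast; linarith)),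
      mul_add, mul_add, ih, integral_optSeq_after hp hp', integral_optSeq_before hp hp' (N + 1),
      Finset.sum_range_succ _ (N + 1)]
    conv_rhs => rw [add_comm]; arg 1; rw [Finset.sum_range_succ]
    ring

lemma energyE_optSeq (hp : 4 < p) (hp' : p ≤ 5) :
    (Summable (fun n : ℕ => ∫ x in ((n : ℝ) + 4 / p)..((n : ℝ) + 1 / 2 + 3 / p),
        Real.sin (p / 2 * π * (x - n)) ^ 2 / (π ^ 2 * x ^ 2)) ∧
      Summable (fun n : ℕ => ∫ x in ((n : ℝ) + 1 / 2 + 3 / p)..((n : ℝ) + 1 + 2 / p),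
        Real.sin (p / 2 * π * (x - n - 1)) ^ 2 / (π ^ 2 * x ^ 2))) ∧
    energyE p (optSeq p) =
      (∫ x in (0 : ℝ)..(2 / p), Real.sin (p / 2 * π * x) ^ 2 / (π ^ 2 * x ^ 2)) +
      (∑' n : ℕ, ∫ x in ((n : ℝ) + 4 / p)..((n : ℝ) + 1 / 2 + 3 / p),
        Real.sin (p / 2 * π * (x - n)) ^ 2 / (π ^ 2 * x ^ 2)) +
      (∑' n : ℕ, ∫ x in ((n : ℝ) + 1 / 2 + 3 / p)..((n : ℝ) + 1 + 2 / p),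
        Real.sin (p / 2 * π * (x - n - 1)) ^ 2 / (π ^ 2 * x ^ 2)) := by
  obtain ⟨h5, h4⟩ := one_div_bounds hp hp'
  have hp0 : p ≠ 0 := by linarith
  have e4 : 4 / p = 4 * (1 / p) := by ring
  have e3 : 3 / p = 3 * (1 / p) := by ring
  have e2 : 2 / p = 2 * (1 / p) := by ring
  have ho := optSeq_halfSeparated hp
  have hpart := integral_optSeq_partial hp hp'
  set I : ℝ := ∫ x in (0 : ℝ)..(2 / p), Real.sin (p / 2 * π * x) ^ 2 / (π ^ 2 * x ^ 2) with hI
  set A : ℕ → ℝ := fun n => ∫ x in ((n : ℝ) + 4 / p)..((n : ℝ) + 1 / 2 + 3 / p),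
        Real.sin (p / 2 * π * (x - n)) ^ 2 / (π ^ 2 * x ^ 2) with hA
  set B : ℕ → ℝ := fun n => ∫ x in ((n : ℝ) + 1 / 2 + 3 / p)..((n : ℝ) + 1 + 2 / p),
        Real.sin (p / 2 * π * (x - n - 1)) ^ 2 / (π ^ 2 * x ^ 2) with hB
  have hI0 : 0 ≤ I := intervalIntegral.integral_nonneg (by linarith) fun x _ => by positivity
  have hA0 : ∀ n, 0 ≤ A n := fun n =>
    intervalIntegral.integral_nonneg (by linarith) fun x _ => by positivity
  have hB0 : ∀ n, 0 ≤ B n := fun n =>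
    intervalIntegral.integral_nonneg (by linarith) fun x _ => by positivity
  have hle : ∀ N, I + ∑ n ∈ Finset.range (N + 1), A n + ∑ n ∈ Finset.range N, B n ≤
      energyE p (optSeq p) := by
    intro N
    have hpos : 0 < optSeq p (N + 1) := by
      rw [optSeq_succ]
      have : (0 : ℝ) ≤ N := Nat.cast_nonneg N
      linarith
    rw [← hpart N, ho.energyE_eq hp0, ho.integral_Ioi_split hp0 hpos]
    gcongr
    rw [le_add_iff_nonneg_right]
    exact setIntegral_nonneg measurableSet_Ioi fun x _ =>
      div_nonneg (density_nonneg _ _ _) (sq_nonneg x)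
  have hAsum : Summable A := by
    refine summable_of_sum_range_le hA0 (c := energyE p (optSeq p)) fun N => ?_
    have h1 := hle N
    rw [Finset.sum_range_succ] at h1
    have h2 := Finset.sum_nonneg fun n (_ : n ∈ Finset.range N) => hB0 n
    linarith [hA0 N]
  have hBsum : Summable B := by
    refine summable_of_sum_range_le hB0 (c := energyE p (optSeq p)) fun N => ?_
    have h1 := hle N
    have h2 := Finset.sum_nonneg fun n (_ : n ∈ Finset.range (N + 1)) => hA0 n
    linarith
  refine ⟨⟨hAsum, hBsum⟩, ?_⟩
  have hlim : Filter.Tendsto (fun N : ℕ => optSeq p (N + 1)) Filter.atTop Filter.atTop := by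
    refine Filter.tendsto_atTop_mono (fun N => ?_) tendsto_natCast_atTop_atTop
    rw [optSeq_succ]
    linarith
  have hl1 := (intervalIntegral_tendsto_integral_Ioi 0
    (ho.integrableOn_density_div_sq hp0) hlim).const_mul (π ^ 2)⁻¹
  rw [← ho.energyE_eq hp0] at hl1
  have hl2 := ((hAsum.hasSum.tendsto_sum_nat.comp
    (Filter.tendsto_add_atTop_nat 1)).const_add I).add hBsum.hasSum.tendsto_sum_nat
  refine tendsto_nhds_unique (hl1.congr fun N => ?_) hl2
  exact hpart N

lemma optSeq_mem {δ₁ δ₂ : ℝ} (hδ₁ : δ₁ ≤ 1 / 2 + 3 / p) (hδ₂ : δ₂ ≤ 1) :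
    optSeq p ∈ sepSeq δ₁ δ₂ := by
  refine ⟨by simp [optSeq], by rwa [optSeq_one], fun n hn => ?_⟩
  obtain ⟨k, rfl⟩ := Nat.exists_eq_add_of_le' hn
  rw [optSeq_succ, optSeq_succ]
  push_cast
  linarith

lemma eq_optSeq_iff {τ : ℕ → ℝ} :
    τ = optSeq p ↔ τ 0 = 0 ∧ ∀ n : ℕ, 1 ≤ n → τ n = (n : ℝ) - 1 / 2 + 3 / p := by
  constructor
  · rintro rfl
    refine ⟨by simp [optSeq], fun n hn => ?_⟩
    rw [optSeq, if_neg (by omega)]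
  · rintro ⟨h0, h⟩
    funext n
    rcases n with _ | n
    · simp [optSeq, h0]
    · rw [h _ (by omega), optSeq, if_neg (by omega)]

end

/-- The first three conjuncts say that the integrals `E_p(τ)`, the supremum and the two series are
genuine (no default values); the last one says that the supremum is attained, exactly at the
sequence `τ_0 = 0`, `τ_n = n - 1/2 + 3/p` for `n ≥ 1`. -/
theorem theorem1p3 (p δ₁ δ₂ : ℝ) (hp : 4 < p) (hp' : p ≤ 5)
    (hδ₁ : 1 / 2 ≤ δ₁) (hδ₁' : δ₁ ≤ 1 / 2 + 3 / p)
    (hδ₂ : 1 - 2 / p ≤ δ₂) (hδ₂' : δ₂ ≤ 1) :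
    (∀ τ ∈ sepSeq δ₁ δ₂,
      IntegrableOn (fun x : ℝ => (max 0 (kernelK p τ x)) ^ 2) (Ioi 0)) ∧
    BddAbove (energyE p '' sepSeq δ₁ δ₂) ∧
    (Summable (fun n : ℕ => ∫ x in ((n : ℝ) + 4 / p)..((n : ℝ) + 1 / 2 + 3 / p),
        Real.sin (p / 2 * π * (x - n)) ^ 2 / (π ^ 2 * x ^ 2)) ∧
      Summable (fun n : ℕ => ∫ x in ((n : ℝ) + 1 / 2 + 3 / p)..((n : ℝ) + 1 + 2 / p),
        Real.sin (p / 2 * π * (x - n - 1)) ^ 2 / (π ^ 2 * x ^ 2))) ∧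
    supE p δ₁ δ₂ =
      (∫ x in (0 : ℝ)..(2 / p), Real.sin (p / 2 * π * x) ^ 2 / (π ^ 2 * x ^ 2)) +
      (∑' n : ℕ, ∫ x in ((n : ℝ) + 4 / p)..((n : ℝ) + 1 / 2 + 3 / p),
        Real.sin (p / 2 * π * (x - n)) ^ 2 / (π ^ 2 * x ^ 2)) +
      (∑' n : ℕ, ∫ x in ((n : ℝ) + 1 / 2 + 3 / p)..((n : ℝ) + 1 + 2 / p),
        Real.sin (p / 2 * π * (x - n - 1)) ^ 2 / (π ^ 2 * x ^ 2)) ∧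
    (∀ τ : ℕ → ℝ, (τ ∈ sepSeq δ₁ δ₂ ∧ energyE p τ = supE p δ₁ δ₂) ↔
      (τ 0 = 0 ∧ ∀ n : ℕ, 1 ≤ n → τ n = (n : ℝ) - 1 / 2 + 3 / p)) := by
  have hp0 : p ≠ 0 := by linarith
  have hsub : ∀ τ ∈ sepSeq δ₁ δ₂, τ ∈ sepSeq (1 / 2) (1 - 2 / p) := fun τ hτ =>
    ⟨hτ.1, hδ₁.trans hτ.2.1, fun n hn => hδ₂.trans (hτ.2.2 n hn)⟩
  have hmem : optSeq p ∈ sepSeq δ₁ δ₂ := optSeq_mem hδ₁' hδ₂'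
  have hgreatest : IsGreatest (energyE p '' sepSeq δ₁ δ₂) (energyE p (optSeq p)) := by
    refine ⟨mem_image_of_mem _ hmem, ?_⟩
    rintro _ ⟨τ, hτ, rfl⟩
    by_cases h : τ = optSeq p
    · rw [h]
    · exact (energyE_lt_optSeq hp hp' (hsub τ hτ) h).le
  have hsup : supE p δ₁ δ₂ = energyE p (optSeq p) := hgreatest.csSup_eq
  obtain ⟨hsummable, hvalue⟩ := energyE_optSeq hp hp'
  refine ⟨fun τ hτ => (halfSeparated_of_mem hp (hsub τ hτ)).integrableOn_kernelK_sq hp0,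
    hgreatest.bddAbove, hsummable, hsup.trans hvalue, fun τ => ?_⟩
  rw [← eq_optSeq_iff, hsup]
  constructor
  · rintro ⟨hτ, he⟩
    by_contra hne
    exact (energyE_lt_optSeq hp hp' (hsub τ hτ) hne).ne he
  · rintro rfl
    exact ⟨hmem, rfl⟩
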